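/- Let $X=[0,1]^2$ be the unit square, and let $B$ be the baker's map $$B(x,y)=\begin{cases}(2x,\ y/2) & \text{if } 0\le x<\tfrac12,\\ (2x-1,\ (y+1)/2) & \text{if } \tfrac12\le x<1,\end{cases}$$ regarded as a bijection of $[0,1)\times[0,1)$ onto itself. A hole is a (relatively) open subset $H$ of $X$. Its survivor set is $$\mathcal J(H)=\{(x,y)\in[0,1)\times[0,1) : B^n(x,y)\notin H \text{ for all } n\in\mathbb Z\},$$ and $H$ is called a dimension trap if $\mathcal J(H)$ has Hausdorff dimension $0$. Theorem. If a convex hole $H$ has area (two-dimensional Lebesgue measure) less than $0.11802$, then $\dim_{\mathtt H}\mathcal J(H)>0$; in particular, $H$ is not a dimension trap. -/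

import Mathlib

/-- The closed unit square `X = [0,1]²`. (`ℝ × ℝ` carries the sup metric, which is bi-Lipschitz
equivalent to the Euclidean one, so Hausdorff dimensions of its subsets are the usual ones.) -/
def unitSquare : Set (ℝ × ℝ) := Set.Icc 0 1 ×ˢ Set.Icc 0 1

/-- The half-open square `[0,1) × [0,1)`, on which the baker's map is a bijection. -/
def halfOpenSquare : Set (ℝ × ℝ) := Set.Ico 0 1 ×ˢ Set.Ico 0 1

/-- The formula of the baker's map: `(x, y) ↦ (2x, y/2)` for `x < 1/2` and
`(x, y) ↦ (2x - 1, (y+1)/2)` for `1/2 ≤ x`. -/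
noncomputable def bakerFun (p : ℝ × ℝ) : ℝ × ℝ :=
  if p.1 < 1 / 2 then (2 * p.1, p.2 / 2) else (2 * p.1 - 1, (p.2 + 1) / 2)

/-- The formula of the inverse of the baker's map. -/
noncomputable def bakerInvFun (p : ℝ × ℝ) : ℝ × ℝ :=
  if p.2 < 1 / 2 then (p.1 / 2, 2 * p.2) else ((p.1 + 1) / 2, 2 * p.2 - 1)

theorem bakerFun_mem {p : ℝ × ℝ} (hp : p ∈ halfOpenSquare) : bakerFun p ∈ halfOpenSquare := by
  obtain ⟨x, y⟩ := p
  simp only [halfOpenSquare, Set.mem_prod, Set.mem_Ico] at hp ⊢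
  obtain ⟨⟨hx0, hx1⟩, hy0, hy1⟩ := hp
  unfold bakerFun
  split_ifs with h <;> simp only at h ⊢ <;>
    refine ⟨⟨?_, ?_⟩, ?_, ?_⟩ <;> linarith

theorem bakerInvFun_mem {p : ℝ × ℝ} (hp : p ∈ halfOpenSquare) :
    bakerInvFun p ∈ halfOpenSquare := by
  obtain ⟨x, y⟩ := p
  simp only [halfOpenSquare, Set.mem_prod, Set.mem_Ico] at hp ⊢
  obtain ⟨⟨hx0, hx1⟩, hy0, hy1⟩ := hp
  unfold bakerInvFun
  split_ifs with h <;> simp only at h ⊢ <;>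
    refine ⟨⟨?_, ?_⟩, ?_, ?_⟩ <;> linarith

theorem bakerInvFun_bakerFun {p : ℝ × ℝ} (hp : p ∈ halfOpenSquare) :
    bakerInvFun (bakerFun p) = p := by
  obtain ⟨x, y⟩ := p
  simp only [halfOpenSquare, Set.mem_prod, Set.mem_Ico] at hp
  obtain ⟨⟨hx0, hx1⟩, hy0, hy1⟩ := hp
  by_cases h : x < 1 / 2
  · have h' : y / 2 < 1 / 2 := by linarith
    simp only [bakerFun, bakerInvFun, if_pos h, if_pos h', Prod.mk.injEq]
    constructor <;> ring
  · have h' : ¬ (y + 1) / 2 < 1 / 2 := by linarith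
    simp only [bakerFun, bakerInvFun, if_neg h, if_neg h', Prod.mk.injEq]
    constructor <;> ring

theorem bakerFun_bakerInvFun {p : ℝ × ℝ} (hp : p ∈ halfOpenSquare) :
    bakerFun (bakerInvFun p) = p := by
  obtain ⟨x, y⟩ := p
  simp only [halfOpenSquare, Set.mem_prod, Set.mem_Ico] at hp
  obtain ⟨⟨hx0, hx1⟩, hy0, hy1⟩ := hp
  by_cases h : y < 1 / 2
  · have h' : x / 2 < 1 / 2 := by linarith
    simp only [bakerFun, bakerInvFun, if_pos h, if_pos h', Prod.mk.injEq]
    constructor <;> ring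
  · have h' : ¬ (x + 1) / 2 < 1 / 2 := by linarith
    simp only [bakerFun, bakerInvFun, if_neg h, if_neg h', Prod.mk.injEq]
    constructor <;> ring

/-- The baker's map `B` as a permutation of `[0,1) × [0,1)`; its integer powers `B ^ n`, `n : ℤ`,
are the forward and backward iterates. -/
noncomputable def bakerMap : Equiv.Perm halfOpenSquare where
  toFun p := ⟨bakerFun p.1, bakerFun_mem p.2⟩
  invFun p := ⟨bakerInvFun p.1, bakerInvFun_mem p.2⟩
  left_inv p := Subtype.ext (bakerInvFun_bakerFun p.2)
  right_inv p := Subtype.ext (bakerFun_bakerInvFun p.2)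

/-- The survivor set `𝒥(H) = {p : Bⁿ(p) ∉ H for all n ∈ ℤ}`. -/
def survivorSet (H : Set (ℝ × ℝ)) : Set (ℝ × ℝ) :=
  {p | ∃ hp : p ∈ halfOpenSquare, ∀ n : ℤ, ((bakerMap ^ n) ⟨p, hp⟩ : ℝ × ℝ) ∉ H}

/-- A hole: a subset of the unit square `X` that is open in the topology of `X`. This covers in
particular every subset of `X` that is open in the plane. -/
def IsHole (H : Set (ℝ × ℝ)) : Prop :=
  ∃ U : Set (ℝ × ℝ), IsOpen U ∧ H = U ∩ unitSquare

/-- A dimension trap: a hole whose survivor set has Hausdorff dimension zero. -/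
def IsDimensionTrap (H : Set (ℝ × ℝ)) : Prop :=
  IsHole H ∧ dimH (survivorSet H) = 0

/-! The contrapositive is proved: a convex hole whose survivor set has dimension zero has area at
least 0.11802. The baker's map is the two-sided shift on binary sequences, the digits to the right
of the origin giving `x` and those to the left giving `y`.

Let `u` and `v` be words with `uv ≠ vu`. For large `k`, the words `A = u^k v u^(k+1) v` and `B =
u^(k+1) v u^k v` are distinct and of equal length, so their free concatenations code a set of
positive dimension (`dimH_survivorSet_pos`). If `H` missed every point coded by these sequences and
their shifts, its survivor set would have positive dimension. Hence `H` contains such a point. Since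
`k|u| ≥ 26`, each factor of length 26 of such a sequence occurs in `u^∞ v u^∞`, so truncating both
coordinates to 13 digits leaves finitely many candidates: `H` comes within `1/8192` of one of the
grid points `windows u v` (`exists_mem_windows_of_dimH_eq_zero`).

Truncation moves points down and left, so thickening `H` by `[-ε, 0]²` with `ε = 1/8192` gives a
convex set `K` that contains the grid points themselves, at a cost in area of at most `2ε + ε²`
(`exists_convex_thickening`). Thus `K` is a convex set hitting each of a finite list of finite
families, and its area can be bounded below by branch and bound (`volume_ge_of_search`). One keeps a
convex polygon with vertices in `K` and chooses a family. A point of the family far enough outside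
the polygon already forces a large area; for each other point the search continues with that point
as a vertex. The choices are read from a certificate whose only role is guidance: the search is
sound for every certificate, and one kernel computation shows that it closes for the given one.

The search starts from `0^∞ 1 0^∞`, whose grid points lie on two sides of the square; exchanging the
coordinates conjugates the map to its inverse and reduces to the lower side. -/

/-! ### Lower bounds for the area of a convex set by triangles -/

/-- The orientation determinant of three points of the plane: twice the signed area of the
triangle `a b c`. -/
def orient (a b c : ℝ × ℝ) : ℝ :=
  (b.1 - a.1) * (c.2 - a.2) - (b.2 - a.2) * (c.1 - a.1)

theorem volume_standard_triangle :
    MeasureTheory.volume {p : ℝ × ℝ | 0 < p.1 ∧ 0 < p.2 ∧ p.1 + p.2 < 1} =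
      ENNReal.ofReal (1 / 2) := by
  have h : {p : ℝ × ℝ | 0 < p.1 ∧ 0 < p.2 ∧ p.1 + p.2 < 1} =
      regionBetween (fun _ => (0 : ℝ)) (fun x => 1 - x) (Set.Ioo 0 1) := by
    ext ⟨x, y⟩
    simp only [regionBetween, Set.mem_ofPred_eq, Set.mem_Ioo]
    constructor
    · rintro ⟨h1, h2, h3⟩
      exact ⟨⟨h1, by linarith⟩, h2, by linarith⟩
    · rintro ⟨⟨h1, h2⟩, h3, h4⟩
      exact ⟨h1, h3, by linarith⟩
  rw [h, MeasureTheory.Measure.volume_eq_prod, volume_regionBetween_eq_integral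
    ((MeasureTheory.integrableOn_const (by simp)).mono_set Set.Ioo_subset_Icc_self)
    ((Continuous.integrableOn_Icc (by fun_prop)).mono_set Set.Ioo_subset_Icc_self)
    measurableSet_Ioo (fun x hx => by linarith [hx.2])]
  congr 1
  rw [← MeasureTheory.integral_Ioc_eq_integral_Ioo,
    ← intervalIntegral.integral_of_le (by norm_num)]
  simp only [Pi.sub_apply, sub_zero]
  rw [intervalIntegral.integral_sub (by simp) (by simp)]
  simp
  norm_num

/-- Adjoining to a part `C` of a convex set `K` lying on one side of the line `a b` the triangle
`a b p` on the other side. -/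
theorem volume_add_triangle_le {K C : Set (ℝ × ℝ)} (hK : Convex ℝ K) (hC : C ⊆ K)
    {a b p : ℝ × ℝ} (ha : a ∈ K) (hb : b ∈ K) (hp : p ∈ K)
    (hside : ∀ z ∈ C, orient a b z ≤ 0) (hpos : 0 ≤ orient a b p) :
    MeasureTheory.volume C + ENNReal.ofReal (orient a b p / 2) ≤ MeasureTheory.volume K := by
  set Δ : Set (ℝ × ℝ) := {p : ℝ × ℝ | 0 < p.1 ∧ 0 < p.2 ∧ p.1 + p.2 < 1} with hΔ
  set M : Matrix (Fin 2) (Fin 2) ℝ := !![b.1 - a.1, p.1 - a.1; b.2 - a.2, p.2 - a.2] with hM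
  set f : ℝ × ℝ →ₗ[ℝ] ℝ × ℝ :=
    Matrix.toLin (Module.Basis.finTwoProd ℝ) (Module.Basis.finTwoProd ℝ) M with hf
  have hfapp : ∀ z : ℝ × ℝ, f z = ((b.1 - a.1) * z.1 + (p.1 - a.1) * z.2,
      (b.2 - a.2) * z.1 + (p.2 - a.2) * z.2) := by
    intro z
    rw [hf, hM, Matrix.toLin_finTwoProd_apply]
  have hdet : LinearMap.det f = orient a b p := by
    rw [hf, LinearMap.det_toLin, hM, Matrix.det_fin_two_of, orient]
    ring
  rcases hpos.eq_or_lt with h0 | h0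
  · rw [← h0]
    simpa using MeasureTheory.measure_mono hC
  have hΔopen : IsOpen Δ := by
    refine (isOpen_lt continuous_const continuous_fst).inter
      ((isOpen_lt continuous_const continuous_snd).inter
        (isOpen_lt (continuous_fst.add continuous_snd) continuous_const))
  set T : Set (ℝ × ℝ) := (fun z => a + z) '' (f '' Δ) with hT
  have hvolT : MeasureTheory.volume T = ENNReal.ofReal (orient a b p / 2) := by
    rw [hT, Set.image_add_left, MeasureTheory.measure_preimage_add,
      MeasureTheory.Measure.addHaar_image_linearMap, hdet, hΔ, volume_standard_triangle,
      abs_of_pos h0, ← ENNReal.ofReal_mul h0.le]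
    congr 1
    ring
  have hTK : T ⊆ K := by
    rintro _ ⟨_, ⟨z, ⟨hz1, hz2, hz3⟩, rfl⟩, rfl⟩
    have := hK.sum_mem (t := Finset.univ) (w := ![1 - z.1 - z.2, z.1, z.2]) (z := ![a, b, p])
      (by intro i _; fin_cases i <;> simp <;> linarith)
      (by simp [Fin.sum_univ_three]; ring) (by intro i _; fin_cases i <;> simp [ha, hb, hp])
    convert this using 1
    rw [hfapp]
    ext <;> simp [Fin.sum_univ_three] <;> ring
  have hTside : ∀ z ∈ T, 0 < orient a b z := by
    rintro _ ⟨_, ⟨z, ⟨hz1, hz2, hz3⟩, rfl⟩, rfl⟩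
    have : orient a b (a + f z) = z.2 * orient a b p := by
      rw [hfapp]
      simp only [orient, Prod.fst_add, Prod.snd_add]
      ring
    rw [this]
    positivity
  have hdisj : Disjoint C T := Set.disjoint_left.2 fun z hz hz' =>
    absurd (hside z hz) (not_le.2 (hTside z hz'))
  have hmeas : MeasurableSet T := by
    have hinj : IsOpen (f '' Δ) := by
      let e := (LinearEquiv.ofIsUnitDet (f := f) (v := Module.Basis.finTwoProd ℝ)
        (v' := Module.Basis.finTwoProd ℝ) (by
          rw [LinearMap.det_toMatrix, hdet]; exact h0.ne'.isUnit)).toContinuousLinearEquiv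
      exact e.toHomeomorph.isOpenMap _ hΔopen
    rw [hT]
    exact ((Homeomorph.addLeft a).isOpenMap _ hinj).measurableSet
  rw [← hvolT, ← MeasureTheory.measure_union hdisj hmeas]
  exact MeasureTheory.measure_mono (Set.union_subset hC hTK)

theorem convex_orient_nonpos (a b : ℝ × ℝ) : Convex ℝ {z | orient a b z ≤ 0} := by
  intro x hx y hy s t hs ht hst
  simp only [Set.mem_ofPred_eq] at hx hy ⊢
  have : orient a b (s • x + t • y) = s * orient a b x + t * orient a b y := by
    simp only [orient, Prod.fst_add, Prod.snd_add, Prod.smul_fst, Prod.smul_snd, smul_eq_mul]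
    linear_combination ((b.1 - a.1) * a.2 - (b.2 - a.2) * a.1) * hst
  rw [this]
  nlinarith [mul_nonneg hs (neg_nonneg.2 hx), mul_nonneg ht (neg_nonneg.2 hy)]

/-- Twice the signed area of the fan with apex `a` over a chain of points. -/
def fan (a : ℝ × ℝ) : List (ℝ × ℝ) → ℝ
  | [] => 0
  | [_] => 0
  | b :: c :: l => orient a b c + fan a (c :: l)

theorem fan_append (a b c : ℝ × ℝ) (l : List (ℝ × ℝ)) :
    fan a (l ++ [b, c]) = fan a (l ++ [b]) + orient a b c := by
  induction l with
  | nil => simp [fan]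
  | cons d l ih =>
    cases l with
    | nil => simp [fan]
    | cons e l => simp only [List.cons_append, fan] at ih ⊢; linarith

theorem fan_nonneg {a : ℝ × ℝ} {l : List (ℝ × ℝ)}
    (h : l.Pairwise fun b c => 0 < orient a b c) : 0 ≤ fan a l := by
  induction l with
  | nil => exact le_rfl
  | cons b l ih =>
    cases l with
    | nil => exact le_rfl
    | cons c l =>
      rw [List.pairwise_cons] at h
      exact add_nonneg (h.1 c (by simp)).le (ih h.2)

/-- The area of a convex set is at least that of a fan inside it. -/
theorem fan_le_volume {a : ℝ × ℝ} (l : List (ℝ × ℝ))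
    (h : l.Pairwise fun b c => 0 < orient a b c) {K : Set (ℝ × ℝ)} (hK : Convex ℝ K)
    (ha : a ∈ K) (hl : ∀ b ∈ l, b ∈ K) :
    ENNReal.ofReal (fan a l / 2) ≤ MeasureTheory.volume K := by
  induction l using List.reverseRecOn generalizing K with
  | nil => simp [fan]
  | append_singleton l c ih =>
    rcases List.eq_nil_or_concat l with rfl | ⟨l, b, rfl⟩
    · simp [fan]
    simp only [List.concat_eq_append] at *
    have hp := List.pairwise_append.1 h
    have hbc : 0 < orient a b c := hp.2.2 b (by simp) c (by simp)
    rw [List.append_assoc, List.singleton_append, fan_append, add_div,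
      ENNReal.ofReal_add (by linarith [fan_nonneg hp.1]) (by linarith)]
    -- The earlier triangles lie on one side of the line `a b` and the last one on the other, so the
    -- induction hypothesis is applied to `K` cut by that line.
    refine le_trans (add_le_add_left (ih (K := K ∩ {z | orient a b z ≤ 0}) hp.1
      (hK.inter (convex_orient_nonpos a b)) ⟨ha, by simp [orient]⟩ ?_) _)
      (volume_add_triangle_le hK Set.inter_subset_left ha (hl b (by simp)) (hl c (by simp))
        (fun z hz => hz.2) hbc.le)
    intro d hd
    refine ⟨hl d (by simp at hd ⊢; tauto), ?_⟩
    rcases List.mem_append.1 hd with hd' | hd'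
    · have := (List.pairwise_append.1 hp.1).2.2 d hd' b (by simp)
      simp only [Set.mem_ofPred_eq]
      have e : orient a b d = - orient a d b := by simp only [orient]; ring
      linarith
    · rw [List.mem_singleton.1 hd']
      simp only [Set.mem_ofPred_eq, orient]
      linarith

/-- The area of a convex set containing a fan and a point beyond its last side. -/
theorem fan_add_triangle_le_volume {a b p : ℝ × ℝ} (l : List (ℝ × ℝ))
    (h : (l ++ [b]).Pairwise fun b c => 0 < orient a b c) {K : Set (ℝ × ℝ)} (hK : Convex ℝ K)
    (ha : a ∈ K) (hl : ∀ c ∈ l ++ [b], c ∈ K) (hp : p ∈ K) (hpos : 0 ≤ orient a b p) :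
    ENNReal.ofReal ((fan a (l ++ [b]) + orient a b p) / 2) ≤ MeasureTheory.volume K := by
  rw [add_div, ENNReal.ofReal_add (by linarith [fan_nonneg h]) (by linarith)]
  refine le_trans (add_le_add_left (fan_le_volume (K := K ∩ {z | orient a b z ≤ 0}) (l ++ [b]) h
      (hK.inter (convex_orient_nonpos a b)) ⟨ha, by simp [orient]⟩ ?_) _)
      (volume_add_triangle_le hK Set.inter_subset_left ha (hl b (by simp)) hp
        (fun z hz => hz.2) hpos)
  intro d hd
  refine ⟨hl d hd, ?_⟩
  rcases List.mem_append.1 hd with hd' | hd'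
  · have := (List.pairwise_append.1 h).2.2 d hd' b (by simp)
    have e : orient a b d = - orient a d b := by simp only [orient]; ring
    simp only [Set.mem_ofPred_eq]
    linarith
  · rw [List.mem_singleton.1 hd']
    simp only [Set.mem_ofPred_eq, orient]
    linarith

/-! ### Thickening a convex set -/

-- By Fubini: each nonempty horizontal slice of `C` is a compact interval, which the sum lengthens
-- by `ε`, and the heights of the nonempty slices lie in `[c, d]`.
open Pointwise in
theorem volume_add_horizontal_segment_le {C : Set (ℝ × ℝ)} (hC : IsCompact C) (hconv : Convex ℝ C)
    {c d ε : ℝ} (hcd : ∀ p ∈ C, p.2 ∈ Set.Icc c d) (hε : 0 ≤ ε) :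
    MeasureTheory.volume (C + Set.Icc (-ε) 0 ×ˢ {0}) ≤
      MeasureTheory.volume C + ENNReal.ofReal ε * ENNReal.ofReal (d - c) := by
  have hK : IsCompact (C + Set.Icc (-ε) 0 ×ˢ ({0} : Set ℝ)) :=
    hC.add (isCompact_Icc.prod isCompact_singleton)
  rw [MeasureTheory.Measure.volume_eq_prod,
    MeasureTheory.Measure.prod_apply_symm hK.measurableSet,
    MeasureTheory.Measure.prod_apply_symm hC.measurableSet]
  have key : ∀ y : ℝ,
      MeasureTheory.volume ((fun x => (x, y)) ⁻¹' (C + Set.Icc (-ε) 0 ×ˢ ({0} : Set ℝ))) ≤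
      MeasureTheory.volume ((fun x => (x, y)) ⁻¹' C) +
        (Set.Icc c d).indicator (fun _ => ENNReal.ofReal ε) y := by
    intro y
    rcases Set.eq_empty_or_nonempty ((fun x => (x, y)) ⁻¹' C) with he | hne
    · have : (fun x => (x, y)) ⁻¹' (C + Set.Icc (-ε) 0 ×ˢ ({0} : Set ℝ)) = ∅ := by
        rw [Set.eq_empty_iff_forall_notMem]
        rintro x ⟨⟨q1, q2⟩, hq, ⟨t1, t2⟩, ⟨ht, ht2⟩, hsum⟩
        simp only [Prod.mk_add_mk, Prod.mk.injEq, Set.mem_singleton_iff] at hsum ht2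
        have hy : q2 = y := by linarith [hsum.2]
        subst hy
        exact (Set.eq_empty_iff_forall_notMem.1 he) q1 hq
      rw [this]
      simp
    · have hcomp : IsCompact ((fun x => (x, y)) ⁻¹' C) := by
        have : (fun x : ℝ => (x, y)) ⁻¹' C = Prod.fst '' (C ∩ {p | p.2 = y}) := by
          ext x
          constructor
          · intro hx
            exact ⟨(x, y), ⟨hx, rfl⟩, rfl⟩
          · rintro ⟨⟨a, b⟩, ⟨h1, h2⟩, h3⟩
            simp only [Set.mem_ofPred_eq] at h2 h3
            subst h2 h3
            exact h1
        rw [this]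
        exact (hC.inter_right (isClosed_eq continuous_snd continuous_const)).image continuous_fst
      have hcv : Convex ℝ ((fun x => (x, y)) ⁻¹' C) := by
        intro x hx z hz s t hs ht hst
        have := hconv hx hz hs ht hst
        simp only [Set.mem_preimage]
        convert this using 1
        ext
        · simp
        · simp only [Prod.snd_add, Prod.smul_snd, smul_eq_mul]
          rw [← add_mul, hst, one_mul]
      have hI := eq_Icc_of_connected_compact ⟨hne, hcv.isPreconnected⟩ hcomp
      set m := sInf ((fun x => (x, y)) ⁻¹' C)
      set M := sSup ((fun x => (x, y)) ⁻¹' C)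
      have hy : y ∈ Set.Icc c d := by
        obtain ⟨x, hx⟩ := hne
        exact hcd _ hx
      have hmM : m ≤ M := by
        obtain ⟨x, hx⟩ := hne
        rw [hI] at hx
        exact hx.1.trans hx.2
      rw [hI, Set.indicator_of_mem hy, Real.volume_Icc, ← ENNReal.ofReal_add (by linarith) hε]
      refine (MeasureTheory.measure_mono (t := Set.Icc (m - ε) M) ?_).trans ?_
      · rintro x ⟨⟨q1, q2⟩, hq, ⟨t1, t2⟩, ⟨ht, ht2⟩, hsum⟩
        simp only [Prod.mk_add_mk, Prod.mk.injEq, Set.mem_singleton_iff] at hsum ht2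
        have hy : q2 = y := by linarith [hsum.2]
        subst hy
        have hq' : q1 ∈ (fun x => (x, q2)) ⁻¹' C := hq
        rw [hI] at hq'
        have := hq'.1
        have := hq'.2
        have := ht.1
        have := ht.2
        simp only at this
        constructor <;> linarith [hsum.1, hq'.1, hq'.2, ht.1, ht.2]
      · rw [Real.volume_Icc]
        exact ENNReal.ofReal_le_ofReal (by linarith)
  refine (MeasureTheory.lintegral_mono key).trans ?_
  rw [MeasureTheory.lintegral_add_right _ (measurable_const.indicator measurableSet_Icc),
    MeasureTheory.lintegral_indicator_const measurableSet_Icc, Real.volume_Icc]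

theorem volume_preimage_swap {C : Set (ℝ × ℝ)}
    (hC : MeasureTheory.NullMeasurableSet C MeasureTheory.volume) :
    MeasureTheory.volume (Prod.swap ⁻¹' C) = MeasureTheory.volume C :=
  (MeasureTheory.Measure.measurePreserving_swap
    (μ := (MeasureTheory.volume : MeasureTheory.Measure ℝ))
    (ν := (MeasureTheory.volume : MeasureTheory.Measure ℝ))).measure_preimage hC

theorem convex_preimage_swap {C : Set (ℝ × ℝ)} (hC : Convex ℝ C) :
    Convex ℝ (Prod.swap ⁻¹' C) :=
  hC.linear_preimage (LinearEquiv.prodComm ℝ ℝ ℝ : (ℝ × ℝ) →ₗ[ℝ] ℝ × ℝ)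

open Pointwise in
/-- A convex subset of the unit square thickened by the square `[-ε, 0]²`. -/
theorem exists_convex_thickening {H : Set (ℝ × ℝ)} (hH : Convex ℝ H) (hsub : H ⊆ unitSquare)
    {ε : ℝ} (hε : 0 ≤ ε) :
    ∃ K : Set (ℝ × ℝ), Convex ℝ K ∧
      (∀ q ∈ H, ∀ p : ℝ × ℝ, q.1 - ε ≤ p.1 → p.1 ≤ q.1 → q.2 - ε ≤ p.2 → p.2 ≤ q.2 → p ∈ K) ∧
      MeasureTheory.volume K ≤ MeasureTheory.volume H + ENNReal.ofReal (2 * ε + ε ^ 2) := by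

  have hcl : closure H ⊆ unitSquare :=
    closure_minimal hsub (isClosed_Icc.prod isClosed_Icc)
  have hCc : IsCompact (closure H) :=
    (isCompact_Icc.prod isCompact_Icc).of_isClosed_subset isClosed_closure hcl
  -- The frontier of a convex set is null, so passing to the closure, which provides compactness,
  -- costs no area.
  have hvol : MeasureTheory.volume (closure H) ≤ MeasureTheory.volume H := by
    calc MeasureTheory.volume (closure H) = MeasureTheory.volume (H ∪ frontier H) := by
          rw [closure_eq_self_union_frontier]
      _ ≤ MeasureTheory.volume H + MeasureTheory.volume (frontier H) :=
          MeasureTheory.measure_union_le _ _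
      _ = MeasureTheory.volume H := by rw [hH.addHaar_frontier MeasureTheory.volume, add_zero]
  set C1 : Set (ℝ × ℝ) := closure H + Set.Icc (-ε) 0 ×ˢ ({0} : Set ℝ) with hC1
  have hC1c : IsCompact C1 := hCc.add (isCompact_Icc.prod isCompact_singleton)
  have hC1v : Convex ℝ C1 :=
    hH.closure.add ((convex_Icc _ _).prod (convex_singleton _))
  set D : Set (ℝ × ℝ) := Prod.swap ⁻¹' C1 with hD
  have hDc : IsCompact D := (Homeomorph.prodComm ℝ ℝ).isCompact_preimage.2 hC1c
  set E : Set (ℝ × ℝ) := D + Set.Icc (-ε) 0 ×ˢ ({0} : Set ℝ) with hE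
  have hEc : IsCompact E := hDc.add (isCompact_Icc.prod isCompact_singleton)
  refine ⟨Prod.swap ⁻¹' E, convex_preimage_swap ((convex_preimage_swap hC1v).add
    ((convex_Icc _ _).prod (convex_singleton _))), ?_, ?_⟩
  · rintro ⟨q1, q2⟩ hq ⟨p1, p2⟩ h1 h2 h3 h4
    simp only at h1 h2 h3 h4
    refine ⟨(q2, p1), ⟨(q1, q2), subset_closure hq, (p1 - q1, 0), ⟨⟨?_, ?_⟩, rfl⟩, ?_⟩,
      (p2 - q2, 0), ⟨⟨?_, ?_⟩, rfl⟩, ?_⟩ <;> simp <;> linarith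
  · rw [volume_preimage_swap hEc.measurableSet.nullMeasurableSet]
    have h1 := volume_add_horizontal_segment_le hCc hH.closure (c := 0) (d := 1)
      (fun p hp => (hcl hp).2) hε
    -- After the first thickening the other coordinate ranges over `[-ε, 1]`; this is the source of
    -- the term `ε²`.
    have h2 := volume_add_horizontal_segment_le hDc (convex_preimage_swap hC1v) (c := -ε) (d := 1)
      (by
        rintro ⟨a, b⟩ ⟨q, hq, t, ⟨ht, -⟩, hsum⟩
        have hq1 := (hcl hq).1
        have : q.1 + t.1 = b := congrArg Prod.fst hsum
        constructor <;> simp only <;> linarith [hq1.1, hq1.2, ht.1, ht.2]) hε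
    rw [volume_preimage_swap hC1c.measurableSet.nullMeasurableSet] at h2
    refine h2.trans ((add_le_add_left (h1.trans (add_le_add_left hvol _)) _).trans ?_)
    rw [← ENNReal.ofReal_mul hε, ← ENNReal.ofReal_mul hε, add_assoc,
      ← ENNReal.ofReal_add (by positivity) (by nlinarith)]
    exact add_le_add_right (ENNReal.ofReal_le_ofReal (by nlinarith)) _

/-! ### Convex polygons and the shoelace formula -/

theorem orient_rotate (a b c : ℝ × ℝ) : orient b c a = orient a b c := by
  simp only [orient]
  ring

/-- The list of points is the boundary of a strictly convex polygon, in counterclockwise order. -/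
def Ccw : List (ℝ × ℝ) → Prop
  | [] => True
  | a :: l => (l.Pairwise fun b c => 0 < orient a b c) ∧ Ccw l

theorem Ccw.sublist {l m : List (ℝ × ℝ)} (h : l.Sublist m) (hm : Ccw m) : Ccw l := by
  induction h with
  | slnil => trivial
  | cons a _ ih => exact ih hm.2
  | cons_cons a hs ih => exact ⟨hm.1.sublist hs, ih hm.2⟩

theorem Ccw.rotate_one {a : ℝ × ℝ} {l : List (ℝ × ℝ)} (h : Ccw (a :: l)) : Ccw (l ++ [a]) := by
  obtain ⟨h1, h2⟩ := h
  induction l with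
  | nil => exact ⟨List.Pairwise.nil, trivial⟩
  | cons b l ih =>
    rw [List.pairwise_cons] at h1
    refine ⟨List.pairwise_append.2 ⟨h2.1, List.pairwise_singleton _ _, ?_⟩, ih h1.2 h2.2⟩
    intro c hc d hd
    rw [List.mem_singleton.1 hd, orient_rotate]
    exact h1.1 c hc

theorem Ccw.swap_append {l m : List (ℝ × ℝ)} (h : Ccw (l ++ m)) : Ccw (m ++ l) := by
  induction l generalizing m with
  | nil => simpa using h
  | cons a l ih =>
    rw [List.cons_append] at h
    have := Ccw.rotate_one h
    rw [List.append_assoc] at this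
    simpa using ih this

/-- Sum of the cross products of consecutive points along a path starting at `a`. -/
def pathSum (a : ℝ × ℝ) : List (ℝ × ℝ) → ℝ
  | [] => 0
  | b :: l => (a.1 * b.2 - a.2 * b.1) + pathSum b l

theorem pathSum_append (a b : ℝ × ℝ) (l m : List (ℝ × ℝ)) :
    pathSum a (l ++ b :: m) = pathSum a (l ++ [b]) + pathSum b m := by
  induction l generalizing a with
  | nil => simp [pathSum]
  | cons c l ih =>
    simp only [List.cons_append, pathSum]
    rw [ih]
    ring

/-- The shoelace formula. The closed sum of cross products is cyclically symmetric, which makes the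
fan area independent of the apex. -/
theorem fan_eq_pathSum (a b : ℝ × ℝ) (l : List (ℝ × ℝ)) :
    fan a (b :: l) = pathSum a (b :: l ++ [a]) := by
  induction l generalizing b with
  | nil =>
    simp only [fan, pathSum, List.cons_append, List.nil_append]
    ring
  | cons c l ih =>
    rw [fan, ih]
    simp only [orient, pathSum, List.cons_append]
    ring

theorem fan_rotate (a b : ℝ × ℝ) (l : List (ℝ × ℝ)) :
    fan b (l ++ [a]) = fan a (b :: l) := by
  rw [fan_eq_pathSum]
  cases l with
  | nil => simp [fan, pathSum]; ring
  | cons c l =>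
    rw [List.cons_append, fan_eq_pathSum]
    have := pathSum_append b a (c :: l) [b]
    simp only [List.cons_append, List.append_assoc, List.nil_append, pathSum] at this ⊢
    linarith

/-- Pairwise left turns as seen from `q` follow from consecutive ones in a half-plane. -/
theorem pairwise_orient_of_isChain {q v : ℝ × ℝ} (a : ℝ × ℝ) (l : List (ℝ × ℝ))
    (ha : 0 ≤ orient q v a) (hv : ∀ b ∈ l, 0 < orient q v b)
    (h : (a :: l).IsChain fun b c => 0 < orient q b c) :
    (a :: l).Pairwise fun b c => 0 < orient q b c := by
  induction l generalizing a with
  | nil => exact List.pairwise_singleton _ _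
  | cons b l ih =>
    rw [List.isChain_cons_cons] at h
    have hb := hv b (by simp)
    have hrec := ih b hb.le (fun c hc => hv c (by simp [hc])) h.2
    refine List.pairwise_cons.2 ⟨?_, hrec⟩
    intro c hc
    rcases List.mem_cons.1 hc with rfl | hc
    · exact h.1
    have hbc := (List.pairwise_cons.1 hrec).1 c hc
    have hvc := hv c (by simp [hc])
    -- The Plücker relation among the four directions from `q` to `v`, `a`, `b`, `c`.
    have key : orient q v b * orient q a c =
        orient q v a * orient q b c + orient q v c * orient q a b := by
      simp only [orient]
      ring
    have : 0 < orient q v b * orient q a c := by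
      rw [key]
      have := mul_nonneg ha hbc.le
      have := mul_pos hvc h.1
      linarith
    exact pos_of_mul_pos_right this hb.le

/-- A point beyond the edge `a b` adds a triangle to the polygon. Moving the apex to `b` makes `a`
the last vertex of the fan, so that this triangle becomes the last one. -/
theorem volume_ge_of_edge {a b p : ℝ × ℝ} {t : List (ℝ × ℝ)} (h : Ccw (a :: b :: t))
    {K : Set (ℝ × ℝ)} (hK : Convex ℝ K) (hl : ∀ c ∈ a :: b :: t, c ∈ K) (hp : p ∈ K)
    (hpos : 0 ≤ orient b a p) :
    ENNReal.ofReal ((fan a (b :: t) + orient b a p) / 2) ≤ MeasureTheory.volume K := by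
  rw [← fan_rotate]
  have h' : Ccw (b :: (t ++ [a])) := by simpa using h.rotate_one
  refine fan_add_triangle_le_volume t h'.1 hK (hl b (by simp)) ?_ hp hpos
  intro c hc
  refine hl c ?_
  simp only [List.mem_append, List.mem_cons, List.not_mem_nil, or_false] at hc ⊢
  tauto

/-- Giving up the vertex `b` loses the triangle `a b c` but gains one on the longer base `a c`,
which is better when `p` is beyond `b` rather than beyond one edge. -/
theorem volume_ge_of_chord {a b c p : ℝ × ℝ} {t : List (ℝ × ℝ)} (h : Ccw (a :: b :: c :: t))
    {K : Set (ℝ × ℝ)} (hK : Convex ℝ K) (hl : ∀ d ∈ a :: b :: c :: t, d ∈ K) (hp : p ∈ K)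
    (hpos : 0 ≤ orient c a p) :
    ENNReal.ofReal ((fan a (b :: c :: t) - orient a b c + orient c a p) / 2) ≤
      MeasureTheory.volume K := by
  have h' : Ccw (a :: c :: t) := h.sublist ((List.sublist_cons_self b (c :: t)).cons_cons a)
  have := volume_ge_of_edge h' hK (fun d hd => hl d (by
    simp only [List.mem_cons] at hd ⊢
    tauto)) hp hpos
  rwa [fan, add_sub_cancel_left]

/-! ### Integer arithmetic for polygons on the grid -/

/-- Evaluates `k` at `n`; definitional reduction evaluates the argument `n` first. -/
def force {α : Type*} (n : ℕ) (k : ℕ → α) : α :=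
  match n with
  | 0 => k 0
  | m + 1 => k (Nat.succ m)

theorem force_eq {α : Type*} (n : ℕ) (k : ℕ → α) : force n k = k n := by
  cases n <;> rfl

/-- A point of the grid `{0, …, 2¹³ - 1}²`. -/
structure Pt where
  x : ℕ
  y : ℕ

namespace Pt

/-- The point of the unit square represented by a grid point. -/
noncomputable def toPlane (p : Pt) : ℝ × ℝ := (p.x / 8192, p.y / 8192)

/-- The grid point lies in the grid. -/
def InGrid (p : Pt) : Prop := p.x < 8192 ∧ p.y < 8192

/-- Positive part of the orientation determinant of `(q, a, b)`. -/
def detPos (q a b : Pt) : ℕ :=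
  Nat.add (Nat.add (Nat.mul q.x a.y) (Nat.mul a.x b.y)) (Nat.mul b.x q.y)

/-- Negative part of the orientation determinant of `(q, a, b)`. -/
def detNeg (q a b : Pt) : ℕ :=
  Nat.add (Nat.add (Nat.mul q.y a.x) (Nat.mul a.y b.x)) (Nat.mul b.y q.x)

/-- Orientation determinant, truncated at zero. -/
def det (q a b : Pt) : ℕ := Nat.sub (detPos q a b) (detNeg q a b)

/-- Twice the area of the fan with apex `q` over a chain of grid points. -/
def fanArea (q : Pt) : List Pt → ℕ
  | [] => 0
  | [_] => 0
  | a :: b :: l => Nat.add (det q a b) (fanArea q (b :: l))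

/-- A chain starting at `v` turns strictly to the left as seen from `q`. -/
def turnsLeft (q v : Pt) : List Pt → Bool
  | [] => true
  | [_] => true
  | a :: b :: l =>
    Nat.blt (detNeg q a b) (detPos q a b) &&
      (Nat.blt (detNeg q v b) (detPos q v b) && turnsLeft q v (b :: l))

theorem orient_toPlane (q a b : Pt) :
    orient q.toPlane a.toPlane b.toPlane = ((detPos q a b : ℝ) - detNeg q a b) / 2 ^ 26 := by
  simp only [orient, toPlane, detPos, detNeg, Nat.add_eq, Nat.mul_eq]
  push_cast
  ring

theorem orient_toPlane_pos_iff (q a b : Pt) :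
    0 < orient q.toPlane a.toPlane b.toPlane ↔ detNeg q a b < detPos q a b := by
  rw [orient_toPlane, div_pos_iff_of_pos_right (by positivity), sub_pos, Nat.cast_lt]

theorem det_eq {q a b : Pt} (h : 0 ≤ orient q.toPlane a.toPlane b.toPlane) :
    (det q a b : ℝ) = 2 ^ 26 * orient q.toPlane a.toPlane b.toPlane := by
  rw [orient_toPlane] at h ⊢
  have h' : detNeg q a b ≤ detPos q a b := by
    by_contra! hlt
    have : (detPos q a b : ℝ) < detNeg q a b := by exact_mod_cast hlt
    have := div_neg_of_neg_of_pos (sub_neg.2 this) (show (0 : ℝ) < 2 ^ 26 by positivity)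
    linarith
  rw [det, Nat.sub_eq, Nat.cast_sub h']
  ring

theorem fanArea_eq {q : Pt} {l : List Pt}
    (h : (l.map toPlane).Pairwise fun b c => 0 < orient q.toPlane b c) :
    (fanArea q l : ℝ) = 2 ^ 26 * fan q.toPlane (l.map toPlane) := by
  induction l with
  | nil => simp [fanArea, fan]
  | cons a l ih =>
    cases l with
    | nil => simp [fanArea, fan]
    | cons b l =>
      rw [List.map_cons, List.pairwise_cons] at h
      rw [fanArea, Nat.add_eq, Nat.cast_add, ih h.2, det_eq (h.1 _ (by simp)).le]
      simp only [List.map_cons, fan]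
      ring

/-- A linear number of determinants suffices: if all points lie to the left of the ray from `q`
through the first one, consecutive left turns imply all the others. -/
theorem pairwise_of_turnsLeft {q v : Pt} {t : List Pt} (h : turnsLeft q v (v :: t) = true) :
    ((v :: t).map toPlane).Pairwise fun b c => 0 < orient q.toPlane b c := by
  have key : ∀ (l : List Pt) (a : Pt), turnsLeft q v (a :: l) = true →
      ((a :: l).map toPlane).IsChain (fun b c => 0 < orient q.toPlane b c) ∧
      ∀ b ∈ l.map toPlane, 0 < orient q.toPlane v.toPlane b := by
    intro l
    induction l with
    | nil => exact fun a _ => ⟨List.isChain_singleton _, by simp⟩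
    | cons b l ih =>
      intro a h
      simp only [turnsLeft, Bool.and_eq_true, Nat.blt_eq] at h
      obtain ⟨h1, h2⟩ := ih b h.2.2
      refine ⟨List.IsChain.cons_cons ((orient_toPlane_pos_iff _ _ _).2 h.1) h1, ?_⟩
      intro c hc
      rcases List.mem_cons.1 hc with rfl | hc
      · exact (orient_toPlane_pos_iff _ _ _).2 h.2.1
      · exact h2 c hc
  obtain ⟨h1, h2⟩ := key t v h
  exact pairwise_orient_of_isChain (v := v.toPlane) _ _
    (by simp [orient, mul_comm]) h2 h1

end Pt

open Pt

/-! ### Affine tests for a large area -/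

/-- Coefficients `(a, b, c)` of an affine functional on the grid. -/
structure Lane where
  a : ℕ
  b : ℕ
  c : ℕ

namespace Lane

/-- The functional exceeds `2³⁰ + 2¹³ (x + y)` at the grid point. -/
def Kills (l : Lane) (p : Pt) : Prop :=
  1073741824 + 8192 * (p.x + p.y) ≤ l.a * p.x + l.b * p.y + l.c

/-- The functional detecting the grid points `p` for which the determinant of `(b, a, p)` is at
least `thr`. -/
def ofChord (b a : Pt) (thr : ℕ) : Lane :=
  -- The determinant is affine in `p` with coefficients of either sign. The shifts by `2¹³` and
  -- `2³⁰` make them natural numbers, and are matched by the other side of `Kills`. For grid points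
  -- and `thr ≤ 2²⁹` no subtraction truncates.
  ⟨Nat.sub (Nat.add b.y 8192) a.y, Nat.sub (Nat.add a.x 8192) b.x,
    Nat.sub (Nat.add 1073741824 (Nat.mul b.x a.y)) (Nat.add (Nat.mul b.y a.x) thr)⟩

theorem le_orient_of_kills {a b p : Pt} {thr : ℕ} (ha : a.InGrid) (hb : b.InGrid)
    (hthr : thr ≤ 536870912) (h : (ofChord b a thr).Kills p) :
    (thr : ℝ) ≤ 2 ^ 26 * orient b.toPlane a.toPlane p.toPlane := by
  obtain ⟨ha1, ha2⟩ := ha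
  obtain ⟨hb1, hb2⟩ := hb
  have h1 : b.y * a.x ≤ 8192 * 8192 := Nat.mul_le_mul hb2.le ha1.le
  simp only [Kills, ofChord, Nat.sub_eq, Nat.add_eq, Nat.mul_eq] at h
  zify [show a.y ≤ b.y + 8192 by omega, show b.x ≤ a.x + 8192 by omega,
    show b.y * a.x + thr ≤ 1073741824 + b.x * a.y by omega] at h
  have h2 : (thr : ℤ) ≤ (detPos b a p : ℤ) - detNeg b a p := by
    simp only [detPos, detNeg, Nat.add_eq, Nat.mul_eq]
    push_cast
    linarith
  have h3 : (thr : ℝ) ≤ (detPos b a p : ℝ) - detNeg b a p := by exact_mod_cast h2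
  rw [orient_toPlane]
  linarith

/-- Functionals attached to the edges and two-step chords of a polygon. -/
def ofPolygon (B area : ℕ) : ℕ → List Pt → List Lane
  | 0, _ => []
  | _ + 1, [] => []
  | _ + 1, [_] => []
  | _ + 1, [a, b] => [ofChord b a B, ofChord a b B]
  | n + 1, a :: b :: c :: t =>
    -- Each threshold is what the remaining polygon lacks to reach `B`: the whole polygon for an
    -- edge, the polygon without `b` for a chord.
    ofChord b a (Nat.sub B area) :: ofChord c a (Nat.sub B (Nat.sub area (det a b c))) ::
      ofPolygon B area n (b :: c :: (t ++ [a]))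

theorem volume_ge_of_ofPolygon {B area : ℕ} (hB : B ≤ 536870912) {K : Set (ℝ × ℝ)}
    (hK : Convex ℝ K) (n : ℕ) (v : Pt) (h : List Pt) (hccw : Ccw ((v :: h).map toPlane))
    (hgrid : ∀ a ∈ v :: h, a.InGrid) (harea : (area : ℝ) = 2 ^ 26 * fan v.toPlane (h.map toPlane))
    (hmem : ∀ a ∈ v :: h, a.toPlane ∈ K) {l : Lane} (hl : l ∈ ofPolygon B area n (v :: h))
    {p : Pt} (hp : p.toPlane ∈ K) (hkill : l.Kills p) :
    ENNReal.ofReal (B / 2 ^ 27) ≤ MeasureTheory.volume K := by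
  have tri : ∀ {a b : Pt} {thr : ℕ} {A : ℝ}, a.InGrid → b.InGrid → thr ≤ 536870912 →
      (ofChord b a thr).Kills p → (B : ℝ) ≤ 2 ^ 26 * A + thr →
      (0 ≤ orient b.toPlane a.toPlane p.toPlane →
        ENNReal.ofReal ((A + orient b.toPlane a.toPlane p.toPlane) / 2) ≤ MeasureTheory.volume K) →
      ENNReal.ofReal (B / 2 ^ 27) ≤ MeasureTheory.volume K := by
    intro a b thr A ha hb hthr hk hA hvol
    have h1 := le_orient_of_kills ha hb hthr hk
    have h2 : (0 : ℝ) ≤ thr := Nat.cast_nonneg _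
    refine le_trans (ENNReal.ofReal_le_ofReal ?_) (hvol (by linarith))
    linarith
  induction n generalizing v h with
  | zero => simp [ofPolygon] at hl
  | succ n ih =>
    match h, hccw, hgrid, harea, hmem, hl with
    | [], _, _, _, _, hl => simp [ofPolygon] at hl
    | [b], hccw, hgrid, harea, hmem, hl =>
      simp only [ofPolygon, List.mem_cons, List.not_mem_nil, or_false] at hl
      have hv := hgrid v (by simp)
      have hb := hgrid b (by simp)
      have hv' := hmem v (by simp)
      have hb' := hmem b (by simp)
      rcases hl with rfl | rfl
      · refine tri hv hb hB hkill (A := 0) (by simp) fun hpos => ?_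
        simpa [fan] using volume_ge_of_edge (a := v.toPlane) (b := b.toPlane) (t := [])
          (by simpa using hccw) hK (by simp [hv', hb']) hp hpos
      · refine tri hb hv hB hkill (A := 0) (by simp) fun hpos => ?_
        simpa [fan] using volume_ge_of_edge (a := b.toPlane) (b := v.toPlane) (t := [])
          (by simpa using hccw.rotate_one) hK (by simp [hv', hb']) hp hpos
    | b :: c :: t, hccw, hgrid, harea, hmem, hl =>
      simp only [ofPolygon, List.mem_cons, Nat.sub_eq] at hl
      have hv := hgrid v (by simp)
      have hb := hgrid b (by simp)
      have hc := hgrid c (by simp)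
      have hmem' : ∀ z ∈ v.toPlane :: b.toPlane :: c.toPlane :: t.map toPlane, z ∈ K := by
        simpa using hmem
      rcases hl with rfl | rfl | hl
      · refine tri hv hb ((Nat.sub_le _ _).trans hB) hkill
          (A := fan v.toPlane ((b :: c :: t).map toPlane)) ?_ fun hpos => ?_
        · rw [← harea]
          have : B ≤ area + (B - area) := by omega
          exact_mod_cast this
        · exact volume_ge_of_edge (by simpa using hccw) hK hmem' hp hpos
      · have hpos' : 0 < orient v.toPlane b.toPlane c.toPlane :=
          (List.pairwise_cons.1 hccw.1).1 _ (by simp)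
        have hd := det_eq hpos'.le
        have hrest : 0 ≤ fan v.toPlane (c.toPlane :: t.map toPlane) :=
          fan_nonneg (List.pairwise_cons.1 hccw.1).2
        refine tri hv hc ((Nat.sub_le _ _).trans hB) hkill
          (A := fan v.toPlane ((b :: c :: t).map toPlane) -
            orient v.toPlane b.toPlane c.toPlane) ?_ fun hpos => ?_
        · rw [mul_sub, ← harea, ← hd]
          have hle : det v b c ≤ area := by
            have : (det v b c : ℝ) ≤ area := by
              rw [harea, hd]
              simp only [List.map_cons, fan]
              nlinarith
            exact_mod_cast this
          have : B ≤ (area - det v b c) + (B - (area - det v b c)) := by omega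
          have h' : (B : ℝ) ≤
              ((area - det v b c : ℕ) : ℝ) + ((B - (area - det v b c) : ℕ) : ℝ) := by
            exact_mod_cast this
          rwa [Nat.cast_sub hle] at h'
        · exact volume_ge_of_chord (by simpa using hccw) hK hmem' hp hpos
      · refine ih b (c :: (t ++ [v])) ?_ ?_ ?_ ?_ hl
        · simpa using hccw.rotate_one
        · intro a ha
          refine hgrid a ?_
          simp only [List.mem_cons, List.mem_append, List.not_mem_nil, or_false] at ha ⊢
          tauto
        · rw [harea]
          congr 1
          have := fan_rotate v.toPlane b.toPlane ((c :: t).map toPlane)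
          simp only [List.map_cons, List.map_append, List.map_nil, List.cons_append] at this ⊢
          exact this.symm
        · intro a ha
          refine hmem a ?_
          simp only [List.mem_cons, List.mem_append, List.not_mem_nil, or_false] at ha ⊢
          tauto

end Lane

/-! ### Testing all functionals at once -/

/-- Several functionals packed in base `2³²`. -/
structure Packed where
  a : ℕ
  b : ℕ
  c : ℕ
  one : ℕ

namespace Packed

/-- Packing of a list of functionals. -/
def ofLanes : List Lane → Packed
  | [] => ⟨0, 0, 0, 0⟩
  | l :: t =>
    match ofLanes t with
    | ⟨a, b, c, one⟩ =>
      force (Nat.add l.a (Nat.mul 4294967296 a)) fun a =>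
      force (Nat.add l.b (Nat.mul 4294967296 b)) fun b =>
      force (Nat.add l.c (Nat.mul 4294967296 c)) fun c =>
      force (Nat.add 1 (Nat.mul 4294967296 one)) fun one => ⟨a, b, c, one⟩

theorem ofLanes_cons (l : Lane) (t : List Lane) :
    ofLanes (l :: t) = ⟨l.a + 4294967296 * (ofLanes t).a, l.b + 4294967296 * (ofLanes t).b,
      l.c + 4294967296 * (ofLanes t).c, 1 + 4294967296 * (ofLanes t).one⟩ := by
  rw [ofLanes]
  simp only [force_eq, Nat.add_eq, Nat.mul_eq]

/-- No packed functional kills the grid point; `M` is the mask of the top bits. -/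
def alive (A B C O M : ℕ) (p : Pt) : Bool :=
  -- Before carries, the digit of a functional is `a x + b y + c + 2³⁰ - 2¹³ (x + y)`, which reaches
  -- `2³¹` exactly when the functional kills `p`.
  Nat.beq (Nat.land (Nat.add (Nat.add (Nat.mul p.x A) (Nat.mul p.y B))
    (Nat.add C (Nat.mul (Nat.sub 1073741824 (Nat.mul 8192 (Nat.add p.x p.y))) O))) M) 0

theorem land_eq_zero {w W M : ℕ} (hw : w < 2147483648) (h : W &&& M = 0) :
    (w + 4294967296 * W) &&& (2147483648 + 4294967296 * M) = 0 := by
  have h1 : (w + 4294967296 * W) / 2 ^ 32 = W := by omega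
  have h2 : (w + 4294967296 * W) % 2 ^ 32 = w := by omega
  have h3 : (2147483648 + 4294967296 * M) / 2 ^ 32 = M := by omega
  have h4 : (2147483648 + 4294967296 * M) % 2 ^ 32 = 2 ^ 31 := by omega
  have e1 : ((w + 4294967296 * W) &&& (2147483648 + 4294967296 * M)) % 2 ^ 32 = 0 := by
    rw [Nat.and_mod_two_pow, h2, h4, Nat.and_two_pow, Nat.testBit_lt_two_pow (by omega)]
    simp
  have e2 : ((w + 4294967296 * W) &&& (2147483648 + 4294967296 * M)) / 2 ^ 32 = 0 := by
    rw [Nat.and_div_two_pow, h1, h3, h]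
  omega

/-- If nothing kills `p`, every digit is below `2³¹`: there are no carries and all masked bits
vanish. Only this direction is needed, so carries out of a killing digit are harmless. -/
theorem exists_kills_of_not_alive {ls : List Lane} {p : Pt} (hp : p.InGrid)
    (h : alive (ofLanes ls).a (ofLanes ls).b (ofLanes ls).c (ofLanes ls).one
      (Nat.mul 2147483648 (ofLanes ls).one) p = false) : ∃ l ∈ ls, l.Kills p := by
  by_contra! hno
  have : alive (ofLanes ls).a (ofLanes ls).b (ofLanes ls).c (ofLanes ls).one
      (Nat.mul 2147483648 (ofLanes ls).one) p = true := by
    clear h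
    simp only [alive, Nat.beq_eq, Nat.add_eq, Nat.mul_eq, Nat.sub_eq]
    change _ &&& _ = 0
    induction ls with
    | nil => simp [ofLanes]
    | cons l t ih =>
      have hl := hno l (by simp)
      have ih := ih fun l' hl' => hno l' (by simp [hl'])
      simp only [Lane.Kills, not_le] at hl
      obtain ⟨h1, h2⟩ := hp
      set u := 1073741824 - 8192 * (p.x + p.y) with hu
      have hu' : u + 8192 * (p.x + p.y) = 1073741824 := by omega
      have := land_eq_zero (w := p.x * l.a + p.y * l.b + l.c + u) (by
        rw [mul_comm p.x, mul_comm p.y]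
        omega) ih
      simp only [ofLanes_cons]
      convert this using 2 <;> ring
  rw [this] at h
  exact absurd h (by simp)

end Packed

/-! ### Branch and bound -/

/-- Runs `sub` on every alive point of a list, threading the certificate; `0` signals failure. -/
def runAlive (al : Pt → Bool) (sub : Pt → ℕ → ℕ) : List Pt → ℕ → ℕ
  | [], c => c
  | p :: l, c =>
    bif al p then
      (match sub p c with
        | 0 => 0
        | c' + 1 => runAlive al sub l (c' + 1))
    else runAlive al sub l c

theorem exists_of_runAlive {al : Pt → Bool} {sub : Pt → ℕ → ℕ} {l : List Pt} {c : ℕ}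
    (h : runAlive al sub l c ≠ 0) {p : Pt} (hp : p ∈ l) (hal : al p = true) :
    ∃ c', sub p c' ≠ 0 := by
  induction l generalizing c with
  | nil => simp at hp
  | cons q l ih =>
    rw [runAlive] at h
    cases hq : al q with
    | false =>
      rw [hq, cond_false] at h
      rcases List.mem_cons.1 hp with rfl | hp
      · rw [hq] at hal
        exact absurd hal (by simp)
      · exact ih h hp
    | true =>
      rw [hq, cond_true] at h
      split at h
      · exact absurd rfl h
      · rename_i c' hc'
        rcases List.mem_cons.1 hp with rfl | hp
        · exact ⟨c, by rw [hc']; simp⟩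
        · exact ih h hp

/-- The `n`-th member of a list of families, or its last member. -/
def family : List (List Pt) → ℕ → List Pt
  | [], _ => []
  | a :: _, 0 => a
  | [a], _ + 1 => a
  | _ :: b :: l, n + 1 => family (b :: l) n

theorem family_mem {pool : List (List Pt)} (h : pool ≠ []) (n : ℕ) : family pool n ∈ pool := by
  induction pool generalizing n with
  | nil => exact absurd rfl h
  | cons a l ih =>
    match l, n with
    | l, 0 => simp [family]
    | [], n + 1 => simp [family]
    | b :: l, n + 1 => exact List.mem_cons_of_mem _ (ih (by simp) n)

/-- Validity of the polygon with first vertex `q` and remaining vertices a chain. -/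
def validChain (q : Pt) : List Pt → Bool
  | [] => true
  | v :: t => turnsLeft q v (v :: t)

/-- Treats the branch of polygons with first vertex `q` and further vertices `ch`. -/
def branch (rec : List Pt → Pt → ℕ → ℕ) (B k : ℕ) (q : Pt) (ch fam : List Pt) (c : ℕ) : ℕ :=
  bif validChain q ch then
    force (fanArea q ch) fun area =>
      (match Packed.ofLanes (Lane.ofPolygon B area (k + 1) (q :: ch)) with
      | ⟨a, b, o, one⟩ =>
        force (Nat.mul 2147483648 one) fun mask =>
          runAlive (Packed.alive a b o one mask) (rec (q :: ch)) fam c)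
  else 0

/-- Branch and bound over the polygons obtained by adding the point `q` to the polygon `h`. The
certificate `c` is a stream of base `2¹⁵` digits `f + 2⁷ (r + 2⁴ k)`: the family to branch on, and
the rotation and number of the vertices of `h` that are kept. -/
def search (B : ℕ) (pool : List (List Pt)) : ℕ → List Pt → Pt → ℕ → ℕ
  | 0, _, _, _ => 0
  | n + 1, h, q, c =>
    branch (search B pool n) B (Nat.div (Nat.mod c 32768) 2048) q
      ((h.drop (Nat.mod (Nat.div (Nat.mod c 32768) 128) 16) ++
        h.take (Nat.mod (Nat.div (Nat.mod c 32768) 128) 16)).take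
          (Nat.div (Nat.mod c 32768) 2048))
      (family pool (Nat.mod c 128)) (Nat.div c 32768)

/-- The chosen family has a point in `K`. If that point is killed, a triangle over an edge or chord
gives the area; otherwise the search also succeeded on the branch where it is the new vertex.
Nothing is assumed about the certificate `c`. -/
theorem volume_ge_of_search {B : ℕ} (hB : B ≤ 536870912) {pool : List (List Pt)}
    (hpool : pool ≠ []) (hgrid : ∀ fam ∈ pool, ∀ p ∈ fam, p.InGrid)
    {K : Set (ℝ × ℝ)} (hK : Convex ℝ K) (hhit : ∀ fam ∈ pool, ∃ p ∈ fam, p.toPlane ∈ K)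
    (n : ℕ) (h : List Pt) (q : Pt) (c : ℕ) (hs : search B pool n h q c ≠ 0) (hccw : Ccw (h.map toPlane))
    (hmem : ∀ a ∈ q :: h, a.InGrid ∧ a.toPlane ∈ K) :
    ENNReal.ofReal (B / 2 ^ 27) ≤ MeasureTheory.volume K := by
  induction n generalizing h q c with
  | zero => exact absurd rfl hs
  | succ n ih =>
    rw [search] at hs
    set k := Nat.div (Nat.mod c 32768) 2048
    set r := Nat.mod (Nat.div (Nat.mod c 32768) 128) 16
    set ch := (h.drop r ++ h.take r).take k with hch
    have hsub : ch.Sublist (h.drop r ++ h.take r) := List.take_sublist _ _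
    have hchmem : ∀ a ∈ ch, a ∈ h := by
      intro a ha
      rcases List.mem_append.1 (hsub.subset ha) with ha | ha
      · exact List.mem_of_mem_drop ha
      · exact List.mem_of_mem_take ha
    -- The kept vertices are a sublist of a rotation of a convex polygon, so convexity has to be
    -- checked only as seen from the new vertex `q`.
    have hchccw : Ccw (ch.map toPlane) := by
      refine Ccw.sublist (hsub.map _) ?_
      rw [List.map_append]
      refine Ccw.swap_append ?_
      rwa [← List.map_append, List.take_append_drop]
    rw [branch] at hs
    cases hv : validChain q ch with
    | false =>
      rw [hv, cond_false] at hs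
      exact absurd rfl hs
    | true =>
      rw [hv, cond_true] at hs
      simp only [force_eq] at hs
      have hpair : (ch.map toPlane).Pairwise fun b c => 0 < orient q.toPlane b c := by
        cases hc : ch with
        | nil => simp
        | cons v t =>
          rw [hc, validChain] at hv
          exact pairwise_of_turnsLeft hv
      have hccw' : Ccw ((q :: ch).map toPlane) := ⟨hpair, hchccw⟩
      have hmem' : ∀ a ∈ q :: ch, a.InGrid ∧ a.toPlane ∈ K := by
        intro a ha
        rcases List.mem_cons.1 ha with rfl | ha
        · exact hmem a (by simp)
        · exact hmem a (by simp [hchmem a ha])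
      · have hf := family_mem hpool (Nat.mod c 128)
        obtain ⟨p, hp, hpK⟩ := hhit _ hf
        have hpg := hgrid _ hf p hp
        generalize hpack : Packed.ofLanes (Lane.ofPolygon B (fanArea q ch) (k + 1) (q :: ch)) = P
          at hs
        cases hal : Packed.alive P.a P.b P.c P.one (Nat.mul 2147483648 P.one) p with
        | true =>
          obtain ⟨c', hc'⟩ := exists_of_runAlive hs hp hal
          refine ih (q :: ch) p c' hc' hccw' ?_
          intro a ha
          rcases List.mem_cons.1 ha with rfl | ha
          · exact ⟨hpg, hpK⟩
          · exact hmem' a ha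
        | false =>
          obtain ⟨l, hl, hkill⟩ := Packed.exists_kills_of_not_alive
            (ls := Lane.ofPolygon B (fanArea q ch) (k + 1) (q :: ch)) hpg (by rw [hpack]; exact hal)
          exact Lane.volume_ge_of_ofPolygon hB hK _ q ch hccw' (fun a ha => (hmem' a ha).1)
            (fanArea_eq hpair) (fun a ha => (hmem' a ha).2) hl hpK hkill

/-! ### Factors of length 26 and their grid points -/

/-- The value of the first `n` binary digits of a word, after the digits with value `acc`. -/
def digitVal : ℕ → ℕ → List Bool → ℕ
  | 0, acc, _ => acc
  | _ + 1, acc, [] => acc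
  | n + 1, acc, b :: l => digitVal n (Nat.add (Nat.mul 2 acc) (bif b then 1 else 0)) l

theorem digitVal_append (n acc : ℕ) (l m : List Bool) (h : l.length = n) :
    digitVal n acc (l ++ m) = digitVal n acc l := by
  induction l generalizing n acc with
  | nil => subst h; rfl
  | cons b l ih =>
    subst h
    simp only [List.length_cons, List.cons_append, digitVal]
    exact ih _ _ rfl

theorem digitVal_lt (n acc : ℕ) (l : List Bool) : digitVal n acc l < (acc + 1) * 2 ^ n := by
  induction n generalizing acc l with
  | zero => simp [digitVal]
  | succ n ih =>
    cases l with
    | nil =>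
      have : 1 ≤ 2 ^ (n + 1) := Nat.one_le_two_pow
      simp only [digitVal]
      nlinarith
    | cons b l =>
      refine (ih _ l).trans_le ?_
      rw [pow_succ, mul_comm (2 ^ n) 2, ← mul_assoc]
      refine Nat.mul_le_mul_right _ ?_
      cases b <;> simp only [Nat.add_eq, Nat.mul_eq, cond_true, cond_false] <;> omega

/-- The grid points read off a two-sided word, given by its reversed left part and its right part,
at all positions with at least 13 letters to the right. -/
def scan : List Bool → List Bool → List Pt
  | _, [] => []
  | l, b :: r =>
    -- Nonempty exactly when `b :: r` has at least 13 letters.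
    match r.drop 11 with
    | [] => []
    | _ :: _ => ⟨digitVal 13 0 (b :: r), digitVal 13 0 l⟩ :: scan (b :: l) r

theorem inGrid_of_mem_scan {l r : List Bool} {p : Pt} (hp : p ∈ scan l r) : p.InGrid := by
  induction r generalizing l with
  | nil => simp [scan] at hp
  | cons b r ih =>
    rw [scan] at hp
    split at hp
    · simp at hp
    · rcases List.mem_cons.1 hp with rfl | hp
      · exact ⟨(digitVal_lt _ _ _).trans_le (by norm_num),
          (digitVal_lt _ _ _).trans_le (by norm_num)⟩
      · exact ih hp

theorem mem_scan (l x b z : List Bool) (hb : b.length = 13) :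
    (⟨digitVal 13 0 b, digitVal 13 0 (x.reverse ++ l)⟩ : Pt) ∈ scan l (x ++ (b ++ z)) := by
  induction x generalizing l with
  | nil =>
    match b, hb with
    | c :: b, hb =>
      have hlen : b.length = 12 := by simpa using hb
      rw [List.nil_append, List.cons_append, scan]
      split
      · rename_i h
        rw [List.drop_eq_nil_iff] at h
        simp only [List.length_append] at h
        omega
      · rw [← List.cons_append, digitVal_append 13 0 (c :: b) z hb]
        simp
  | cons c x ih =>
    rw [List.cons_append, scan]
    split
    · rename_i h
      rw [List.drop_eq_nil_iff] at h
      simp only [List.length_append] at h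
      omega
    · refine List.mem_cons_of_mem _ ?_
      have := ih (c :: l)
      simpa using this

/-- The power of a word. -/
def wpow (u : List Bool) : ℕ → List Bool
  | 0 => []
  | n + 1 => u ++ wpow u n

theorem length_wpow (u : List Bool) (n : ℕ) : (wpow u n).length = n * u.length := by
  induction n with
  | zero => simp [wpow]
  | succ n ih =>
    rw [wpow, List.length_append, ih]
    ring

theorem wpow_succ' (u : List Bool) (n : ℕ) : wpow u (n + 1) = wpow u n ++ u := by
  induction n with
  | zero => simp [wpow]
  | succ n ih =>
    conv_lhs => rw [wpow, ih, ← List.append_assoc]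
    rfl

theorem getElem?_wpow (u : List Bool) (n i : ℕ) (h : i < n * u.length) :
    (wpow u n)[i]? = u[i % u.length]? := by
  induction n generalizing i with
  | zero => simp at h
  | succ n ih =>
    rw [wpow]
    by_cases hi : i < u.length
    · rw [List.getElem?_append_left hi, Nat.mod_eq_of_lt hi]
    · rw [not_lt] at hi
      have h' : i - u.length < n * u.length := by
        rw [Nat.succ_mul] at h
        omega
      rw [List.getElem?_append_right hi, ih _ h', ← Nat.mod_eq_sub_mod hi]

/-- A finite word having as factors of length 26 those of the two-sided word `u^∞ v u^∞`. -/
def core (u v : List Bool) : List Bool :=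
  -- The left part has `25 + |u|` letters, room for a factor of length 26 at each of the `|u|`
  -- phases of the period. A factor starting before the end of `v` uses at most 25 letters after
  -- `v`.
  (wpow u (26 / u.length + 2)).drop ((26 / u.length + 2) * u.length - (25 + u.length)) ++
    (v ++ (wpow u (26 / u.length + 2)).take 25)

theorem infix_of_eq_take_drop {w l : List Bool} {j n : ℕ} (h : w = (l.drop j).take n) :
    w <:+: l := by
  rw [h]
  exact (List.take_prefix _ _).isInfix.trans (List.drop_suffix _ _).isInfix

theorem exists_take_drop_of_infix {w l : List Bool} (h : w <:+: l) :
    ∃ j, j + w.length ≤ l.length ∧ w = (l.drop j).take w.length := by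
  obtain ⟨s, t, rfl⟩ := h
  refine ⟨s.length, by simp, ?_⟩
  rw [List.append_assoc, List.drop_left, List.take_left]

theorem div_mul_bounds {n : ℕ} (hn : 0 < n) : 26 + n < (26 / n + 2) * n := by
  have h1 := Nat.div_add_mod 26 n
  have h2 := Nat.mod_lt 26 hn
  nlinarith

theorem infix_drop_of_infix_wpow {u w : List Bool} (hu : u ≠ []) (hw : w.length = 26)
    (h : w <:+: wpow u (26 / u.length + 2)) :
    w <:+: (wpow u (26 / u.length + 2)).drop
      ((26 / u.length + 2) * u.length - (25 + u.length)) := by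
  have hn : 0 < u.length := List.length_pos_iff.2 hu
  obtain ⟨j, hj, hwj⟩ := exists_take_drop_of_infix h
  rw [length_wpow] at hj
  have hb := div_mul_bounds hn
  set m := 26 / u.length + 2
  set D := m * u.length - (25 + u.length) with hD
  rw [hw] at hj hwj
  have hmod := Nat.mod_lt (j + D * u.length - D) hn
  -- The phase for which `D + e ≡ j` modulo `|u|`; the multiple `D * u.length` keeps the subtraction
  -- from truncating.
  set e := (j + D * u.length - D) % u.length with he
  have hDle : D ≤ D * u.length := Nat.le_mul_of_pos_right _ hn
  refine infix_of_eq_take_drop (j := e) (n := 26) ?_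
  rw [hwj, List.drop_drop]
  refine List.ext_getElem? fun t => ?_
  rw [List.getElem?_take, List.getElem?_take]
  split
  · rename_i ht
    rw [List.getElem?_drop, List.getElem?_drop, getElem?_wpow _ _ _ (by omega),
      getElem?_wpow _ _ _ (by omega)]
    congr 1
    have h1 : D + e ≡ j [MOD u.length] := by
      have : e ≡ j + D * u.length - D [MOD u.length] := Nat.mod_modEq _ _
      have h2 := this.add_left D
      rw [show D + (j + D * u.length - D) = j + D * u.length by omega] at h2
      exact h2.trans (by simp [Nat.ModEq])
    exact (h1.symm.add_right t)
  · rfl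

theorem infix_append_cases {w x m y : List Bool} (hw : w.length ≤ m.length)
    (h : w <:+: x ++ (m ++ y)) : w <:+: x ++ m ∨ w <:+: m ++ y := by
  obtain ⟨j, hj, hwj⟩ := exists_take_drop_of_infix h
  rcases le_or_gt x.length j with hx | hx
  · right
    refine infix_of_eq_take_drop (j := j - x.length) (n := w.length) ?_
    rw [List.drop_append, List.drop_eq_nil_of_le hx, List.nil_append] at hwj
    exact hwj
  · left
    refine infix_of_eq_take_drop (j := j) (n := w.length) ?_
    rw [← List.append_assoc, List.drop_append_of_le_length (by simp; omega),
      List.take_append_of_le_length (by simp; omega)] at hwj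
    exact hwj

theorem infix_core {u v w : List Bool} (hu : u ≠ []) (hw : w.length = 26)
    (h : w <:+: wpow u (26 / u.length + 2) ++ (v ++ wpow u (26 / u.length + 2))) :
    w <:+: core u v := by
  have hn : 0 < u.length := List.length_pos_iff.2 hu
  have hper := fun h => infix_drop_of_infix_wpow (w := w) hu hw h
  obtain ⟨j, hj, hwj⟩ := exists_take_drop_of_infix h
  have hb := div_mul_bounds hn
  have hlen := length_wpow u (26 / u.length + 2)
  rw [core]
  generalize hm : 26 / u.length + 2 = m at *
  set P := wpow u m
  set D := m * u.length - (25 + u.length) with hD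
  rw [hw] at hj hwj
  simp only [List.length_append, hlen] at hj
  have hleft : ∀ {l}, w <:+: P → w <:+: P.drop D ++ l := fun h =>
    (hper h).trans (List.prefix_append _ _).isInfix
  rcases lt_or_ge j D with h1 | h1
  · refine hleft (infix_of_eq_take_drop (j := j) (n := 26) ?_)
    rwa [List.drop_append_of_le_length (by omega), List.take_append_of_le_length (by simp; omega)]
      at hwj
  · rcases lt_or_ge j (P.length + v.length) with h2 | h2
    · refine infix_of_eq_take_drop (j := j - D) (n := 26) ?_
      rw [hwj]
      refine List.ext_getElem? fun t => ?_
      rw [List.getElem?_take, List.getElem?_take]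
      split
      · rename_i ht
        have hPD : (P.drop D).length = 25 + u.length := by simp; omega
        rw [List.getElem?_drop, List.getElem?_drop]
        rcases lt_or_ge (j + t) P.length with h3 | h3
        · rw [List.getElem?_append_left h3, List.getElem?_append_left (by omega),
            List.getElem?_drop]
          congr 1
          omega
        · rw [List.getElem?_append_right h3,
            List.getElem?_append_right (l₁ := P.drop D) (by omega)]
          rcases lt_or_ge (j + t - P.length) v.length with h4 | h4
          · rw [List.getElem?_append_left h4, List.getElem?_append_left (by omega)]
            congr 1
            omega
          · rw [List.getElem?_append_right h4, List.getElem?_append_right (by omega),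
              List.getElem?_take, if_pos (by omega)]
            congr 1
            omega
      · rfl
    · refine hleft (infix_of_eq_take_drop (j := j - P.length - v.length) (n := 26) ?_)
      rw [← List.append_assoc, List.drop_append, List.drop_eq_nil_of_le (by simpa using h2),
        List.nil_append] at hwj
      rw [hwj]
      congr 2
      simp
      omega

/-- The grid points of the two-sided word `u^∞ v u^∞`. -/
def windows (u v : List Bool) : List Pt :=
  scan ((core u v).take 13).reverse ((core u v).drop 13)

theorem mem_windows {u v a b : List Bool} (hu : u ≠ []) (ha : a.length = 13) (hb : b.length = 13)
    (h : a ++ b <:+: wpow u (26 / u.length + 2) ++ (v ++ wpow u (26 / u.length + 2))) :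
    (⟨digitVal 13 0 b, digitVal 13 0 a.reverse⟩ : Pt) ∈ windows u v := by
  obtain ⟨s, t, hst⟩ := infix_core hu (by simp [ha, hb]) h
  have h1 : core u v = (s ++ a) ++ (b ++ t) := by
    rw [← hst]
    simp
  have h2 : 13 ≤ (s ++ a).length := by simp [ha]
  rw [windows, h1, List.take_append_of_le_length h2, List.drop_append_of_le_length h2]
  have := mem_scan ((s ++ a).take 13).reverse ((s ++ a).drop 13) b t hb
  rwa [← List.reverse_append, List.take_append_drop, List.reverse_append,
    digitVal_append 13 0 a.reverse _ (by simpa using ha)] at this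

/-! ### Symbolic coding of the baker's map -/

/-- The real number with the given binary digits. -/
noncomputable def binVal (f : ℕ → Bool) : ℝ :=
  Real.ofDigits fun k => (bif f k then 1 else 0 : Fin 2)

theorem binVal_nonneg (f : ℕ → Bool) : 0 ≤ binVal f := Real.ofDigits_nonneg _

theorem binVal_le_one (f : ℕ → Bool) : binVal f ≤ 1 := Real.ofDigits_le_one _

theorem binVal_succ (f : ℕ → Bool) :
    binVal f = ((bif f 0 then 1 else 0 : ℕ) + binVal fun k => f (k + 1)) / 2 := by
  rw [binVal, Real.ofDigits_eq_sum_add_ofDigits _ 1]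
  simp only [Finset.range_one, Finset.sum_singleton, Real.ofDigitsTerm, binVal]
  cases f 0 <;> simp <;> ring

/-- The digits of a binary expansion, read up to position `n`, locate its value. -/
theorem digitVal_bounds (n acc : ℕ) (f : ℕ → Bool) :
    (digitVal n acc ((List.range n).map f) : ℝ) ≤ (acc + binVal f) * 2 ^ n ∧
      (acc + binVal f) * 2 ^ n ≤ digitVal n acc ((List.range n).map f) + 1 := by
  induction n generalizing acc f with
  | zero =>
    have := binVal_nonneg f
    have := binVal_le_one f
    simp only [digitVal, pow_zero, mul_one]
    constructor <;> linarith
  | succ n ih =>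
    rw [List.range_succ_eq_map, List.map_cons, List.map_map, digitVal]
    have := ih (Nat.add (Nat.mul 2 acc) (bif f 0 then 1 else 0)) fun k => f (k + 1)
    have e : (((Nat.add (Nat.mul 2 acc) (bif f 0 then 1 else 0) : ℕ) : ℝ) +
        binVal fun k => f (k + 1)) * 2 ^ n = (acc + binVal f) * 2 ^ (n + 1) := by
      rw [binVal_succ f, Nat.add_eq, Nat.mul_eq]
      push_cast
      ring
    rw [e] at this
    exact this

theorem binVal_lt_one {f : ℕ → Bool} {k : ℕ} (hk : f k = false) : binVal f < 1 := by
  induction k generalizing f with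
  | zero =>
    rw [binVal_succ, hk]
    have := binVal_le_one fun k => f (k + 1)
    simp only [cond_false, Nat.cast_zero, zero_add]
    linarith
  | succ k ih =>
    have := ih (f := fun k => f (k + 1)) hk
    rw [binVal_succ]
    cases f 0 <;> simp only [cond_false, cond_true, Nat.cast_zero, Nat.cast_one] <;> linarith

/-- The sequence shifted by `n`. -/
def shiftSeq (n : ℤ) (s : ℤ → Bool) : ℤ → Bool := fun i => s (i + n)

/-- The point of the square coded by a two-sided binary sequence. -/
noncomputable def codedPoint (s : ℤ → Bool) : ℝ × ℝ :=
  (binVal fun k => s k, binVal fun k => s (-1 - k))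

theorem codedPoint_mem {s : ℤ → Bool} (h1 : ∃ k : ℕ, s k = false)
    (h2 : ∃ k : ℕ, s (-1 - k) = false) : codedPoint s ∈ halfOpenSquare := by
  obtain ⟨k, hk⟩ := h1
  obtain ⟨m, hm⟩ := h2
  exact ⟨⟨binVal_nonneg _, binVal_lt_one (f := fun k : ℕ => s k) hk⟩,
    binVal_nonneg _, binVal_lt_one (f := fun k : ℕ => s (-1 - k)) hm⟩

/-- A zero digit after position 0 makes the tail value less than 1, so the branch of the map is
decided by `s 0` even though binary expansions are not unique. -/
theorem bakerFun_codedPoint {s : ℤ → Bool} (h : ∃ k : ℕ, s (k + 1) = false) :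
    bakerFun (codedPoint s) = codedPoint (shiftSeq 1 s) := by
  obtain ⟨k, hk⟩ := h
  have h1 : binVal (fun k : ℕ => s k) =
      ((bif s 0 then 1 else 0 : ℕ) + binVal fun k : ℕ => s (k + 1)) / 2 := by
    rw [binVal_succ]
    simp
  have h2 : binVal (fun k : ℕ => shiftSeq 1 s (-1 - k)) =
      ((bif s 0 then 1 else 0 : ℕ) + binVal fun k : ℕ => s (-1 - k)) / 2 := by
    rw [binVal_succ]
    simp [shiftSeq]
    ring_nf
  have hlt := binVal_lt_one (f := fun k : ℕ => s (k + 1)) hk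
  have hnn := binVal_nonneg (fun k : ℕ => s (k + 1))
  cases hs : s 0 with
  | false =>
    rw [hs, cond_false, Nat.cast_zero, zero_add] at h1 h2
    have hc : (codedPoint s).1 < 1 / 2 := by
      change binVal (fun k : ℕ => s k) < 1 / 2
      linarith
    rw [bakerFun, if_pos hc]
    refine Prod.ext ?_ h2.symm
    change 2 * binVal (fun k : ℕ => s k) = binVal fun k : ℕ => s (k + 1)
    linarith
  | true =>
    rw [hs, cond_true, Nat.cast_one] at h1 h2
    have hc : ¬ (codedPoint s).1 < 1 / 2 := by
      change ¬ binVal (fun k : ℕ => s k) < 1 / 2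
      linarith
    rw [bakerFun, if_neg hc]
    refine Prod.ext ?_ ((congrArg (· / 2) (add_comm _ _)).trans h2.symm)
    change 2 * binVal (fun k : ℕ => s k) - 1 = binVal fun k : ℕ => s (k + 1)
    linarith

theorem perm_zpow_orbit {α : Type*} (f : Equiv.Perm α) (q : ℤ → α) (h : ∀ n, f (q n) = q (n + 1))
    (n : ℤ) : (f ^ n) (q 0) = q n := by
  induction n with
  | zero => rfl
  | succ n ih => rw [add_comm, zpow_add, zpow_one, Equiv.Perm.mul_apply, ih, h, add_comm]
  | pred n ih =>
    rw [sub_eq_neg_add, zpow_add, zpow_neg_one, Equiv.Perm.mul_apply, ih, Equiv.Perm.inv_eq_iff_eq,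
      h, add_comm (-1), add_assoc]
    simp

/-- If the whole shift orbit of a sequence avoids the hole, the coded point survives. -/
theorem codedPoint_mem_survivorSet {s : ℤ → Bool} {H : Set (ℝ × ℝ)}
    (h1 : ∀ i : ℤ, ∃ k : ℕ, s (i + k) = false) (h2 : ∀ i : ℤ, ∃ k : ℕ, s (i - k) = false)
    (h : ∀ n : ℤ, codedPoint (shiftSeq n s) ∉ H) : codedPoint s ∈ survivorSet H := by
  have hmem : ∀ n : ℤ, codedPoint (shiftSeq n s) ∈ halfOpenSquare := by
    intro n
    obtain ⟨k, hk⟩ := h1 n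
    obtain ⟨m, hm⟩ := h2 (n - 1)
    refine codedPoint_mem ⟨k, ?_⟩ ⟨m, ?_⟩
    · rw [shiftSeq, add_comm, hk]
    · rw [shiftSeq, show (-1 - m + n : ℤ) = n - 1 - m by ring, hm]
  have key := perm_zpow_orbit bakerMap (fun n => ⟨codedPoint (shiftSeq n s), hmem n⟩) (by
    intro n
    refine Subtype.ext ?_
    obtain ⟨k, hk⟩ := h1 (n + 1)
    have := bakerFun_codedPoint (s := shiftSeq n s) ⟨k, by
      rw [shiftSeq, show (k + 1 + n : ℤ) = n + 1 + k by ring, hk]⟩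
    change bakerFun (codedPoint (shiftSeq n s)) = codedPoint (shiftSeq (n + 1) s)
    rw [this]
    congr 1
    funext i
    simp only [shiftSeq]
    congr 1
    ring)
  have h0 : shiftSeq 0 s = s := by
    funext i
    simp [shiftSeq]
  refine ⟨by simpa [h0] using hmem 0, fun n => ?_⟩
  have := key n
  simp only [h0] at this
  rw [this]
  exact h n

/-! ### Block sequences -/

/-- The two-sided sequence made of copies of the words `A` and `B` in the order given by `c`. -/
def blockSeq (A B : List Bool) (c : ℤ → Bool) : ℤ → Bool := fun i =>
  ((bif c (i / A.length) then B else A)[(i % A.length).toNat]?).getD false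

theorem blockSeq_apply (A B : List Bool) (c : ℤ → Bool) (m : ℤ) {t : ℕ} (ht : t < A.length) :
    blockSeq A B c (m * A.length + t) = ((bif c m then B else A)[t]?).getD false := by
  have hpos : (0 : ℤ) < A.length := by omega
  have h1 : (m * A.length + t) / (A.length : ℤ) = m := by
    rw [add_comm, Int.add_mul_ediv_right _ _ hpos.ne', Int.ediv_eq_zero_of_lt (by omega) (by omega),
      zero_add]
  have h2 : (m * A.length + t) % (A.length : ℤ) = t := by
    rw [add_comm, Int.add_mul_emod_self_right, Int.emod_eq_of_lt (by omega) (by omega)]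
  rw [blockSeq, h1, h2, Int.toNat_natCast]

theorem exists_blockSeq_eq {A B : List Bool} (hlen : B.length = A.length) {b : Bool} (hA : b ∈ A)
    (hB : b ∈ B) (c : ℤ → Bool) (m : ℤ) :
    ∃ t : ℕ, t < A.length ∧ blockSeq A B c (m * A.length + t) = b := by
  have : ∃ t : ℕ, t < A.length ∧ ((bif c m then B else A)[t]?).getD false = b := by
    cases c m
    · obtain ⟨t, ht, rfl⟩ := List.getElem_of_mem hA
      exact ⟨t, ht, by simp [ht]⟩
    · obtain ⟨t, ht, rfl⟩ := List.getElem_of_mem hB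
      exact ⟨t, hlen ▸ ht, by simp [ht]⟩
  obtain ⟨t, ht, h⟩ := this
  exact ⟨t, ht, by rw [blockSeq_apply _ _ _ _ ht, h]⟩

theorem exists_blockSeq_eq_right {A B : List Bool} (hlen : B.length = A.length) {b : Bool}
    (hA : b ∈ A) (hB : b ∈ B) (c : ℤ → Bool) (i : ℤ) :
    ∃ k : ℕ, k < 2 * A.length ∧ blockSeq A B c (i + k) = b := by
  obtain ⟨t, ht, h⟩ := exists_blockSeq_eq hlen hA hB c (i / A.length + 1)
  have h1 := Int.emod_add_mul_ediv i A.length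
  have h2 := Int.emod_nonneg i (b := (A.length : ℤ)) (by omega)
  have h3 := Int.emod_lt_of_pos i (b := (A.length : ℤ)) (by omega)
  have h4 : (i / A.length + 1) * A.length = A.length * (i / A.length) + (A.length : ℤ) := by ring
  refine ⟨((i / A.length + 1) * A.length + t - i).toNat, by omega, ?_⟩
  rw [Int.toNat_of_nonneg (by omega), add_sub_cancel, h]

theorem exists_blockSeq_eq_left {A B : List Bool} (hlen : B.length = A.length) {b : Bool}
    (hA : b ∈ A) (hB : b ∈ B) (c : ℤ → Bool) (i : ℤ) :
    ∃ k : ℕ, blockSeq A B c (i - k) = b := by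
  obtain ⟨t, ht, h⟩ := exists_blockSeq_eq hlen hA hB c (i / A.length - 1)
  have h1 := Int.emod_add_mul_ediv i A.length
  have h2 := Int.emod_nonneg i (b := (A.length : ℤ)) (by omega)
  have h4 : (i / A.length - 1) * A.length = A.length * (i / A.length) - (A.length : ℤ) := by ring
  refine ⟨(i - ((i / A.length - 1) * A.length + t)).toNat, ?_⟩
  rw [Int.toNat_of_nonneg (by omega), sub_sub_cancel, h]

/-- Short factors of a block sequence are factors of a product of two blocks. -/
theorem blockSeq_window {A B : List Bool} (hlen : B.length = A.length) {n : ℕ} (hn : n ≤ A.length)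
    (hpos : 0 < A.length) (c : ℤ → Bool) (i : ℤ) :
    (List.range n).map (fun t : ℕ => blockSeq A B c (i + t)) <:+:
      (bif c (i / A.length) then B else A) ++ (bif c (i / A.length + 1) then B else A) := by
  have h1 := Int.emod_add_mul_ediv i A.length
  have h2 := Int.emod_nonneg i (b := (A.length : ℤ)) (by omega)
  have h3 := Int.emod_lt_of_pos i (b := (A.length : ℤ)) (by omega)
  have hb : ∀ b : Bool, (bif b then B else A).length = A.length := by
    intro b
    cases b
    · rfl
    · exact hlen
  set m := i / A.length
  obtain ⟨j, hj⟩ := Int.eq_ofNat_of_zero_le h2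
  refine infix_of_eq_take_drop (j := j) (n := n) (List.ext_getElem? fun t => ?_)
  rw [List.getElem?_take]
  split
  · rename_i ht
    rw [List.getElem?_map, List.getElem?_range ht, Option.map_some, List.getElem?_drop]
    rcases lt_or_ge (j + t) A.length with h | h
    · have e : i + t = m * A.length + (j + t : ℕ) := by
        push_cast
        linarith
      rw [e, blockSeq_apply _ _ _ _ h, List.getElem?_append_left (by rw [hb]; exact h),
        List.getElem?_eq_getElem (by rw [hb]; exact h), Option.getD_some]
    · have e : i + t = (m + 1) * A.length + (j + t - A.length : ℕ) := by
        push_cast [Nat.cast_sub h]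
        linarith
      have h' : j + t - A.length < A.length := by omega
      rw [e, blockSeq_apply _ _ _ _ h', List.getElem?_append_right (by rw [hb]; exact h), hb,
        List.getElem?_eq_getElem (by rw [hb]; exact h'), Option.getD_some]
  · rename_i ht
    simpa using ht

/-- The factors of length 26 of a word in long powers of `u` separated by `v`. -/
theorem infix_of_infix_blocks {u v w p₁ p₂ p₃ p₄ : List Bool} {k : ℕ} (hk : w.length ≤ k * u.length)
    (h₁ : p₁ = wpow u k ∨ p₁ = wpow u (k + 1)) (h₂ : p₂ = wpow u k ∨ p₂ = wpow u (k + 1))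
    (h₃ : p₃ = wpow u k ∨ p₃ = wpow u (k + 1)) (h₄ : p₄ = wpow u k ∨ p₄ = wpow u (k + 1))
    (h : w <:+: (p₁ ++ (v ++ (p₂ ++ v))) ++ (p₃ ++ (v ++ (p₄ ++ v)))) :
    w <:+: wpow u (k + 1) ++ (v ++ wpow u (k + 1)) := by
  have hlen : ∀ {p}, p = wpow u k ∨ p = wpow u (k + 1) → w.length ≤ p.length := by
    rintro p (rfl | rfl) <;> rw [length_wpow]
    · exact hk
    · nlinarith
  have hsuf : ∀ {p}, p = wpow u k ∨ p = wpow u (k + 1) → p <:+ wpow u (k + 1) := by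
    rintro p (rfl | rfl)
    · exact ⟨u, rfl⟩
    · exact List.suffix_rfl
  have hpre : ∀ {p}, p = wpow u k ∨ p = wpow u (k + 1) → p <+: wpow u (k + 1) := by
    rintro p (rfl | rfl)
    · exact ⟨u, (wpow_succ' u k).symm⟩
    · exact List.prefix_rfl
  have key : ∀ {p q}, (p = wpow u k ∨ p = wpow u (k + 1)) → (q = wpow u k ∨ q = wpow u (k + 1)) →
      p ++ (v ++ q) <:+: wpow u (k + 1) ++ (v ++ wpow u (k + 1)) := by
    intro p q hp hq
    obtain ⟨s, hs⟩ := hsuf hp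
    obtain ⟨t, ht⟩ := hpre hq
    refine ⟨s, t, ?_⟩
    rw [show wpow u (k + 1) ++ (v ++ wpow u (k + 1)) = (s ++ p) ++ (v ++ (q ++ t)) by rw [hs, ht]]
    simp only [List.append_assoc]
  rw [show (p₁ ++ (v ++ (p₂ ++ v))) ++ (p₃ ++ (v ++ (p₄ ++ v))) =
    (p₁ ++ v) ++ (p₂ ++ (v ++ (p₃ ++ (v ++ (p₄ ++ v))))) by simp only [List.append_assoc]] at h
  -- `w` is no longer than any of the powers of `u`, so it cannot stretch past both ends of one;
  -- three such cuts isolate a single `v`.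
  rcases infix_append_cases (hlen h₂) h with h | h
  · rw [List.append_assoc] at h
    exact h.trans (key h₁ h₂)
  rw [← List.append_assoc p₂] at h
  rcases infix_append_cases (hlen h₃) h with h | h
  · rw [List.append_assoc] at h
    exact h.trans (key h₂ h₃)
  rw [← List.append_assoc p₃] at h
  rcases infix_append_cases (hlen h₄) h with h | h
  · rw [List.append_assoc] at h
    exact h.trans (key h₃ h₄)
  · exact (h.trans ⟨[], wpow u k, by simp⟩).trans (key h₄ (Or.inl rfl))

/-- Points coded by block sequences over powers of `u` separated by `v` are close to grid points of
the two-sided word `u^∞ v u^∞`. -/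
theorem exists_mem_windows_near {u v : List Bool} (hu : u ≠ []) {A B : List Bool}
    (hA : A = wpow u (26 / u.length + 1) ++ (v ++ (wpow u (26 / u.length + 2) ++ v)))
    (hB : B = wpow u (26 / u.length + 2) ++ (v ++ (wpow u (26 / u.length + 1) ++ v)))
    (c : ℤ → Bool) (i : ℤ) :
    ∃ p ∈ windows u v,
      (codedPoint (shiftSeq i (blockSeq A B c))).1 - 1 / 8192 ≤ p.toPlane.1 ∧
      p.toPlane.1 ≤ (codedPoint (shiftSeq i (blockSeq A B c))).1 ∧
      (codedPoint (shiftSeq i (blockSeq A B c))).2 - 1 / 8192 ≤ p.toPlane.2 ∧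
      p.toPlane.2 ≤ (codedPoint (shiftSeq i (blockSeq A B c))).2 := by
  have hlen : B.length = A.length := by
    rw [hA, hB]
    simp only [List.length_append]
    ring
  have hn : 0 < u.length := List.length_pos_iff.2 hu
  have hk : 26 ≤ (26 / u.length + 1) * u.length := by
    have := div_mul_bounds hn
    nlinarith
  have hAl : 26 ≤ A.length := by
    rw [hA, List.length_append, length_wpow]
    omega
  set s := blockSeq A B c with hs
  have hw := blockSeq_window (n := 26) hlen hAl (by omega) c (i - 13)
  rw [← hs] at hw
  set a := (List.range 13).map (fun t : ℕ => s (i - 13 + t)) with ha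
  set b := (List.range 13).map (fun t : ℕ => s (t + i)) with hb
  have hab : (List.range 26).map (fun t : ℕ => s (i - 13 + t)) = a ++ b := by
    rw [show 26 = 13 + 13 from rfl, List.range_add, List.map_append, List.map_map]
    congr 1
    refine List.map_congr_left fun t _ => ?_
    simp only [Function.comp, Nat.cast_add]
    congr 1
    push_cast
    ring
  have har : a.reverse = (List.range 13).map (fun t : ℕ => s (-1 - t + i)) := by
    rw [ha]
    simp only [List.range_succ, List.range_zero]
    simp
    ring_nf
    simp
  have hinf : a ++ b <:+: wpow u (26 / u.length + 2) ++ (v ++ wpow u (26 / u.length + 2)) := by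
    rw [hab] at hw
    have hc : ∀ x : Bool, ∃ p q, (p = wpow u (26 / u.length + 1) ∨ p = wpow u (26 / u.length + 2)) ∧
        (q = wpow u (26 / u.length + 1) ∨ q = wpow u (26 / u.length + 2)) ∧
        (bif x then B else A) = p ++ (v ++ (q ++ v)) := by
      intro x
      cases x
      · exact ⟨_, _, Or.inl rfl, Or.inr rfl, hA⟩
      · exact ⟨_, _, Or.inr rfl, Or.inl rfl, hB⟩
    obtain ⟨p₁, p₂, h₁, h₂, e₁⟩ := hc (c ((i - 13) / A.length))
    obtain ⟨p₃, p₄, h₃, h₄, e₂⟩ := hc (c ((i - 13) / A.length + 1))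
    rw [e₁, e₂] at hw
    exact infix_of_infix_blocks (by simpa [ha, hb] using hk) h₁ h₂ h₃ h₄ hw
  refine ⟨_, mem_windows hu (by simp [ha]) (by simp [hb]) hinf, ?_⟩
  have h1 := digitVal_bounds 13 0 fun t : ℕ => s (t + i)
  have h2 := digitVal_bounds 13 0 fun t : ℕ => s (-1 - t + i)
  rw [← hb] at h1
  rw [← har] at h2
  norm_num at h1 h2
  simp only [Pt.toPlane, codedPoint, shiftSeq]
  refine ⟨?_, ?_, ?_, ?_⟩ <;> linarith

/-! ### Positive dimension of the survivor set -/

theorem binVal_le_of_exists {f : ℕ → Bool} {m : ℕ} (h : ∃ j < m, f j = false) :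
    binVal f ≤ 1 - (1 / 2) ^ m := by
  induction m generalizing f with
  | zero => simp at h
  | succ m ih =>
    rw [binVal_succ]
    have hle := binVal_le_one fun k => f (k + 1)
    have hp : ((1 : ℝ) / 2) ^ m ≤ 1 := pow_le_one₀ (by norm_num) (by norm_num)
    rw [pow_succ]
    cases h0 : f 0 with
    | false =>
      rw [cond_false, Nat.cast_zero]
      linarith
    | true =>
      obtain ⟨j, hj, hfj⟩ := h
      cases j with
      | zero => simp [h0] at hfj
      | succ j =>
        have := ih (f := fun k => f (k + 1)) ⟨j, by omega, hfj⟩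
        rw [cond_true, Nat.cast_one]
        linarith

/-- A lower bound for the difference of two binary expansions. -/
theorem binVal_gap {f g : ℕ → Bool} {n m : ℕ} (h : ∀ i < n, f i = g i) (hf : f n = true)
    (hg : g n = false) (hm : ∃ j < m, g (n + 1 + j) = false) :
    (1 / 2) ^ (n + 1 + m) ≤ binVal f - binVal g := by
  induction n generalizing f g with
  | zero =>
    have h1 := binVal_le_of_exists (f := fun k => g (k + 1)) (m := m) (by
      obtain ⟨j, hj, h⟩ := hm
      exact ⟨j, hj, by rw [← h]; congr 1; ring⟩)
    have h2 := binVal_nonneg fun k => f (k + 1)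
    rw [binVal_succ f, binVal_succ g, hf, hg, cond_true, cond_false, zero_add, pow_add]
    push_cast
    linarith
  | succ n ih =>
    have := ih (f := fun k => f (k + 1)) (g := fun k => g (k + 1))
      (fun i hi => h _ (by omega)) hf hg
      (by
        obtain ⟨j, hj, h⟩ := hm
        exact ⟨j, hj, by rw [← h]; congr 1; ring⟩)
    rw [binVal_succ f, binVal_succ g, h 0 (by omega), show n + 1 + 1 + m = n + 1 + m + 1 by ring,
      pow_succ]
    linarith

theorem abs_binVal_sub_le {f g : ℕ → Bool} {n : ℕ} (h : ∀ i < n, f i = g i) :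
    |binVal f - binVal g| ≤ (1 / 2) ^ n := by
  have := Real.abs_ofDigits_sub_ofDigits_le (x := fun k => (bif f k then 1 else 0 : Fin 2))
    (y := fun k => (bif g k then 1 else 0 : Fin 2)) (n := n) (fun i hi => by simp only [h i hi])
  rw [one_div, inv_pow]
  exact_mod_cast this

theorem exists_binVal_eq {x : ℝ} (hx : x ∈ Set.Icc (0 : ℝ) 1) : ∃ f, binVal f = x := by
  obtain ⟨d, -, hd⟩ := Real.ofDigits_SurjOn (b := 2) (by norm_num) hx
  refine ⟨fun k => decide (d k = 1), ?_⟩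
  rw [← hd, binVal]
  congr 1
  funext k
  generalize d k = z
  fin_cases z <;> simp

open NNReal ENNReal in
/-- A set parametrized by an inverse Hölder map over the unit interval has positive dimension. -/
theorem dimH_range_pos {ι X : Type*} [MetricSpace X] {g : ι → X} {b : ι → ℝ} {M : ℝ}
    {n : ℕ} (hn : n ≠ 0) (hM : 0 ≤ M) (hb : Set.Icc 0 1 ⊆ Set.range b)
    (h : ∀ i j, |b i - b j| ^ n ≤ M * dist (g i) (g j)) : 0 < dimH (Set.range g) := by
  have hfac : b.FactorsThrough g := by
    intro i j hij
    have := h i j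
    rw [hij, dist_self, mul_zero] at this
    have h0 := pow_eq_zero_iff hn |>.1 (this.antisymm (by positivity))
    exact sub_eq_zero.1 (abs_eq_zero.1 h0)
  -- The inequality makes `b` a function of `g`. That function is Hölder of exponent `1 / n` and its
  -- image contains `[0, 1]`, so the range of `g` has dimension at least `1 / n`.
  set F := Function.extend g b 0 with hF
  have hFg : ∀ i, F (g i) = b i := fun i => hfac.extend_apply 0 i
  have hn' : (n : ℝ) ≠ 0 := by exact_mod_cast hn
  have hhol : HolderOnWith (M.toNNReal ^ (1 / n : ℝ)) (1 / n : ℝ≥0) F (Set.range g) := by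
    rintro _ ⟨i, rfl⟩ _ ⟨j, rfl⟩
    rw [hFg, hFg, edist_nndist, edist_nndist, ← ENNReal.coe_rpow_of_nonneg _ (by positivity),
      ← ENNReal.coe_mul, ENNReal.coe_le_coe]
    have hr : ((1 / n : ℝ≥0) : ℝ) = 1 / n := by push_cast; rfl
    rw [hr, ← NNReal.mul_rpow, one_div, NNReal.le_rpow_inv_iff (by positivity), NNReal.rpow_natCast,
      ← NNReal.coe_le_coe]
    push_cast
    rw [Real.coe_toNNReal _ hM, Real.dist_eq]
    exact h i j
  have himg : (1 : ℝ≥0∞) ≤ dimH (F '' Set.range g) := by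
    have h1 : dimH (Set.Icc (0 : ℝ) 1) = 1 := by
      rw [Real.dimH_of_nonempty_interior (by simp)]
      simp
    rw [← h1]
    refine dimH_mono fun x hx => ?_
    obtain ⟨i, rfl⟩ := hb hx
    exact ⟨g i, ⟨i, rfl⟩, hFg i⟩
  have hle := himg.trans (hhol.dimH_image_le (by positivity))
  rw [pos_iff_ne_zero]
  intro h0
  rw [h0, ENNReal.zero_div] at hle
  exact absurd hle (by simp)

/-- Two words over a single letter commute. Both letters therefore recur in the block sequences,
which excludes expansions ending in ones. -/
theorem mem_of_append_ne {u v : List Bool} (h : u ++ v ≠ v ++ u) (b : Bool) : b ∈ u ++ v := by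
  by_contra hb
  apply h
  have hu : u = List.replicate u.length (!b) :=
    List.eq_replicate_iff.2 ⟨rfl, fun x hx => by
      have : x ≠ b := fun e => hb (List.mem_append_left _ (e ▸ hx))
      revert this
      cases x <;> cases b <;> decide⟩
  have hv : v = List.replicate v.length (!b) :=
    List.eq_replicate_iff.2 ⟨rfl, fun x hx => by
      have : x ≠ b := fun e => hb (List.mem_append_right _ (e ▸ hx))
      revert this
      cases x <;> cases b <;> decide⟩
  rw [hu, hv, List.replicate_append_replicate, List.replicate_append_replicate, add_comm]

/-- A hole that avoids all points coded by the block sequences over two words of equal length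
has a survivor set of positive dimension. -/
theorem dimH_survivorSet_pos {A B : List Bool} (hlen : B.length = A.length) (hne : A ≠ B)
    (hmemA : ∀ b, b ∈ A) (hmemB : ∀ b, b ∈ B) {H : Set (ℝ × ℝ)}
    (h : ∀ c n, codedPoint (shiftSeq n (blockSeq A B c)) ∉ H) : 0 < dimH (survivorSet H) := by
  have hpos : 0 < A.length := List.length_pos_of_mem (hmemA true)
  set ℓ := A.length with hℓ
  let s : (ℕ → Bool) → ℤ → Bool := fun c => blockSeq A B fun i => c i.toNat
  have hr : ∀ c b (i : ℤ), ∃ k : ℕ, k < 2 * ℓ ∧ s c (i + k) = b := fun c b i =>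
    exists_blockSeq_eq_right hlen (hmemA b) (hmemB b) _ i
  have hl : ∀ c b (i : ℤ), ∃ k : ℕ, s c (i - k) = b := fun c b i =>
    exists_blockSeq_eq_left hlen (hmemA b) (hmemB b) _ i
  have hsurv : ∀ c, codedPoint (s c) ∈ survivorSet H := fun c =>
    codedPoint_mem_survivorSet (fun i => let ⟨k, _, hk⟩ := hr c false i; ⟨k, hk⟩) (hl c false) (h _)
  refine lt_of_lt_of_le (dimH_range_pos (g := fun c => codedPoint (s c)) (b := binVal)
    (M := 2 ^ (3 * ℓ + 1)) hpos.ne' (by positivity) (fun x hx => exists_binVal_eq hx) ?_)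
    (dimH_mono (Set.range_subset_iff.2 hsurv))
  have hblock : ∀ c (k t : ℕ), t < ℓ →
      s c ((k * ℓ + t : ℕ) : ℤ) = ((bif c k then B else A)[t]?).getD false := by
    intro c k t ht
    have := blockSeq_apply A B (fun i => c i.toNat) k ht
    rw [Int.toNat_natCast] at this
    rw [← this]
    push_cast
    rfl
  have hinj : ∀ c d k, (∀ t < ℓ, s c ((k * ℓ + t : ℕ) : ℤ) = s d ((k * ℓ + t : ℕ) : ℤ)) →
      c k = d k := by
    intro c d k hk
    have hAB : ¬ ∀ t < ℓ, (A[t]?).getD false = (B[t]?).getD false := by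
      intro hAB
      refine hne (List.ext_getElem hlen.symm fun t h1 h2 => ?_)
      have := hAB t h1
      rwa [List.getElem?_eq_getElem h1, List.getElem?_eq_getElem h2] at this
    by_contra hcd
    apply hAB
    intro t ht
    have := hk t ht
    rw [hblock _ _ _ ht, hblock _ _ _ ht] at this
    cases hc : c k <;> cases hd : d k <;> simp_all
  have key : ∀ c d : ℕ → Bool, ∀ n : ℕ, (∀ i < n, s c (i : ℤ) = s d (i : ℤ)) →
      s c (n : ℤ) = true → s d (n : ℤ) = false →
      |binVal c - binVal d| ^ ℓ ≤ 2 ^ (3 * ℓ + 1) * dist (codedPoint (s c)) (codedPoint (s d)) := by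
    intro c d n hlt hc hd
    -- Letter `n` is the first difference. The smaller expansion has another zero among its next
    -- `2ℓ` letters, which bounds the gap below by `2^-(n + 1 + 2ℓ)`, while `c` and `d` agree on
    -- their first `n / ℓ` terms.
    have hgap := binVal_gap (f := fun k : ℕ => s c k) (g := fun k : ℕ => s d k) (m := 2 * ℓ) hlt hc
      hd (by
        obtain ⟨k, hk, h⟩ := hr d false (n + 1)
        exact ⟨k, hk, by rw [← h]; push_cast; rfl⟩)
    have hup : |binVal c - binVal d| ≤ (1 / 2) ^ (n / ℓ) := by
      refine abs_binVal_sub_le fun i hi => hinj c d i fun t ht => hlt _ ?_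
      have : (i + 1) * ℓ ≤ n := (Nat.le_div_iff_mul_le hpos).1 hi
      nlinarith
    have hdist : (binVal fun k : ℕ => s c k) - (binVal fun k : ℕ => s d k) ≤
        dist (codedPoint (s c)) (codedPoint (s d)) := by
      refine (le_abs_self _).trans ?_
      rw [← Real.dist_eq]
      exact le_max_left _ _
    have hn : n ≤ n / ℓ * ℓ + ℓ := by
      have h1 := Nat.div_add_mod n ℓ
      have h2 := Nat.mod_lt n hpos
      nlinarith
    calc |binVal c - binVal d| ^ ℓ ≤ ((1 / 2) ^ (n / ℓ)) ^ ℓ :=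
          pow_le_pow_left₀ (abs_nonneg _) hup _
      _ = 2 ^ ℓ * (1 / 2) ^ (n / ℓ * ℓ + ℓ) := by
          rw [← pow_mul, pow_add, mul_left_comm, ← mul_pow]
          norm_num
      _ ≤ 2 ^ ℓ * (1 / 2) ^ n :=
          mul_le_mul_of_nonneg_left (pow_le_pow_of_le_one (by norm_num) (by norm_num) hn)
            (by positivity)
      _ = 2 ^ (3 * ℓ + 1) * (1 / 2) ^ (n + 1 + 2 * ℓ) := by
          rw [show 3 * ℓ + 1 = ℓ + (1 + 2 * ℓ) by ring, pow_add 2 ℓ, add_assoc n,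
            pow_add (1 / 2 : ℝ) n, mul_assoc, mul_left_comm _ ((1 / 2 : ℝ) ^ n), ← mul_pow]
          norm_num
      _ ≤ _ := mul_le_mul_of_nonneg_left (hgap.trans hdist) (by positivity)
  intro c d
  by_cases heq : ∀ n : ℕ, s c n = s d n
  · have : c = d := funext fun k => hinj c d k fun t _ => heq _
    rw [this, sub_self, abs_zero, zero_pow hpos.ne']
    positivity
  · rw [not_forall] at heq
    classical
    have hmin : ∀ i < Nat.find heq, s c i = s d i := fun i hi => not_not.1 (Nat.find_min heq hi)
    have hn := Nat.find_spec heq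
    cases hc : s c (Nat.find heq) with
    | true =>
      rw [hc] at hn
      exact key c d _ hmin hc (Bool.eq_false_iff.2 fun h => hn h.symm)
    | false =>
      rw [hc] at hn
      rw [abs_sub_comm, dist_comm]
      exact key d c _ (fun i hi => (hmin i hi).symm) (by
        cases hd : s d (Nat.find heq) with
        | true => rfl
        | false => exact absurd hd.symm hn) hc

/-- A hole with a zero-dimensional survivor set contains, up to a small error, a grid point of the
two-sided word `u^∞ v u^∞`. -/
theorem exists_mem_windows_of_dimH_eq_zero {H : Set (ℝ × ℝ)} (hdim : dimH (survivorSet H) = 0)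
    {u v : List Bool} (huv : u ++ v ≠ v ++ u) :
    ∃ q ∈ H, ∃ p ∈ windows u v, q.1 - 1 / 8192 ≤ p.toPlane.1 ∧ p.toPlane.1 ≤ q.1 ∧
      q.2 - 1 / 8192 ≤ p.toPlane.2 ∧ p.toPlane.2 ≤ q.2 := by
  have hu : u ≠ [] := by
    rintro rfl
    simp at huv
  by_contra hcon
  refine hdim.not_gt (dimH_survivorSet_pos
    (A := wpow u (26 / u.length + 1) ++ (v ++ (wpow u (26 / u.length + 2) ++ v)))
    (B := wpow u (26 / u.length + 2) ++ (v ++ (wpow u (26 / u.length + 1) ++ v))) ?_ ?_ ?_ ?_ ?_)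
  · simp only [List.length_append]
    ring
  · intro h
    have e := wpow_succ' u (26 / u.length + 1)
    apply huv.symm
    -- Equality of the two blocks, after cancelling the common prefix and suffix, would read `v u =
    -- u v`.
    have h' : wpow u (26 / u.length + 1) ++ (v ++ (u ++ (wpow u (26 / u.length + 1) ++ v))) =
        wpow u (26 / u.length + 1) ++ (u ++ (v ++ (wpow u (26 / u.length + 1) ++ v))) := by
      rw [← List.append_assoc (wpow u _) u, ← e, ← List.append_assoc u]
      exact h
    rw [List.append_cancel_left_eq, ← List.append_assoc v, ← List.append_assoc u,
      List.append_cancel_right_eq] at h'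
    exact h'
  · intro b
    have := mem_of_append_ne huv b
    rw [wpow]
    simp only [List.mem_append] at this ⊢
    tauto
  · intro b
    have := mem_of_append_ne huv b
    rw [wpow]
    simp only [List.mem_append] at this ⊢
    tauto
  · intro c n hmem
    obtain ⟨p, hp, hq⟩ := exists_mem_windows_near hu rfl rfl c n (v := v)
    exact hcon ⟨_, hmem, p, hp, hq⟩

/-! ### The words, the certificate and the finite verification -/

/-- Decodes the word whose letters are the binary digits after the leading one of a number with
at most `n` digits, in front of the word `acc`. -/
def word : ℕ → ℕ → List Bool → List Bool
  | 0, _, acc => acc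
  | n + 1, c, acc =>
    bif Nat.ble c 1 then acc else word n (Nat.div c 2) (Nat.beq (Nat.mod c 2) 1 :: acc)

/-- Pairs of words `(u, v)`, in the coding of `word`. -/
def wordCodes : List (ℕ × ℕ) :=
  [(2, 3), (457, 41), (6, 19), (6, 39), (2, 13), (5, 198), (114, 10), (153, 25), (10, 6), (13,
   9), (11, 12), (405, 5), (12, 2), (362, 6), (5, 56), (13, 5), (5, 15), (25, 11), (5, 30), (11,
   13), (5, 14), (11, 6), (6, 45), (554, 6), (12, 45), (2, 31), (12, 93), (3, 2), (1737, 41),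
   (310, 54), (108, 2), (3, 20), (3, 18), (10, 14), (230, 22), (5, 24), (83, 3), (6, 2), (3,
   10), (2, 27), (12, 10), (3, 4), (1334, 54), (5, 51), (2, 7), (28, 10), (19, 13), (23145,
   105), (6, 44), (9, 7), (2457, 25), (12, 11), (5, 6), (2996516, 12), (6, 185), (11, 98), (11,
   3), (5, 7), (14, 2), (25, 5), (3686, 22), (6, 17), (6, 8), (5, 3), (6, 9), (9, 3), (198, 38),
   (6, 4), (12, 39), (6, 5), (206, 46), (26006, 86), (11, 50), (22, 6), (12, 5)]

/-- The pairs of words used by the search. -/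
def wordPairs : List (List Bool × List Bool) :=
  wordCodes.map fun c => (word 32 c.1 [], word 32 c.2 [])

/-- The families of grid points used by the search. -/
def pool : List (List Pt) := wordPairs.map fun w => windows w.1 w.2

/-- The grid points of the two-sided word `0^∞ 1 0^∞` on the lower side of the square. -/
def rootPoints : List Pt := (windows [false] [true]).filter fun p => Nat.beq p.y 0

/-- Evaluates `k` at a list; definitional reduction evaluates the coordinates first. -/
def forcePoints {α : Type*} : List Pt → (List Pt → α) → α
  | [], k => k []
  | ⟨x, y⟩ :: l, k => force x fun x => force y fun y => forcePoints l fun l => k (⟨x, y⟩ :: l)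

theorem forcePoints_eq {α : Type*} (l : List Pt) (k : List Pt → α) : forcePoints l k = k l := by
  induction l generalizing k with
  | nil => rfl
  | cons p l ih => simp only [forcePoints, force_eq, ih]

/-- Evaluates `k` at a list of lists; definitional reduction evaluates the coordinates first. -/
def forceFamilies {α : Type*} : List (List Pt) → (List (List Pt) → α) → α
  | [], k => k []
  | a :: l, k => forcePoints a fun a => forceFamilies l fun l => k (a :: l)

theorem forceFamilies_eq {α : Type*} (l : List (List Pt)) (k : List (List Pt) → α) :
    forceFamilies l k = k l := by
  induction l generalizing k with
  | nil => rfl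
  | cons p l ih => simp only [forceFamilies, forcePoints_eq, ih]

/-- The certificate for `search`. -/
def certificate : ℕ :=
  0x90ad105842b441610ad105842b441610ad105842b441610ad105842b441610ad105840a4856882c208a64a4c9490ad10584118c949929325260b4c94992932524324854882c215842b08561902404c80990822026404c630885620b43006640881608292170403c84610883170403c84610883170403c84610883170403c84610883170403c846188c211062e0807908c31184220807983d328642f8c1e9943217c60f4ca190be3086650c85f183e307c42d145a29b4438664208619934307a425cc1e9943217c60f4ca190be211842e084790b8211e42e084790b8211e42e0c5c108f217062e0847981232724240c09193921206048c9c9090307264e4848181030204315462a9c54372643c85c994530244240c09193921206048c9c90902170a4cd422b10a6214c4298853a337466e8cdd19ba8a7514ea2a51bd3b7a26f2a6a1a4babbaa5f54be949ca4987774c4e624c1bb8692eaedd455247a48f4ca25a4c1bba5514aa291acabb99272ad6649d235992748d6009c235a827244ea09c913a827244e05ada13a92776a2d09d493bb51684ea49dbb592276e4e489db939227504ea24ca93996b2ad6649cab5992722ee9944b4983770e2a01ac2b5806b28d601aca358026e8d6a144cbba627204e989c813a627204e29add93b451524eec9da28a927764ed5ac813b527204ed49c813a62744ee9c9cca898150a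4e01ac2b5806b0ad601ac1c98692eaee949ca498777304e0ddbabb7514ea29d453a8a7514e8cdd19ba337466c43d885310a6214a2218c530c56390a6294cb298a4274ca594452a155474a60508aa0ba406c8315459aa484274a92109d20ba4244a92109d21bc438a86add433a186514c8a194529b34182ca75459aa4a5382a6750a52041410aa261120a89844828305103a898448286c905820a2430e82890c3a0ba430e821d043a0c15362e8c9890b2327478ca2585e3a326242e885d10ba216464e81e084c10986650cc9c5bc1098212eca9d03c10982130cca19938b782130425d953a07821304261994332716f0426084bb2a740ecaf1d03b98973130cca60b4c168664e21dcc4b9897654e8c9cc4b98986650cc9c43b9897312eca9d03b98973130cca60b4c168664e21dcc4b9897654e81d95e3a097412e82585e3a326242c8c9d1e32896178e8c9890b2325338ea298d53a8a63548305060ba8a6354a2c9043a087410e8725904a99c6412a67105d3209533882f10e0a0a2430e82890c3a0a233766314c609934217064c0c5c108f3170423cc5c108f3170423c85c108f207e4230c9f993f327e64fcc9590b8317064fcc9f993f327e403cc461088327e64fcc9f993f327e42e0c5c193f327e64fc807988c211042e0807988c211042e0807988c211042e0807908c211042e0807882543328664c2290c5211c40b08149094104e42988539829213c20b085a10bb1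0584298856882c215a20b0856882c215a20b0856882c215a20b0856882c215a20b0856882c215a20b000d90a5315862308059825216842d085a10a5104e4294c56188c2016609485a10b42168429441390a5315862308059825216842d085a10a5104e4294c56188c2016609485a10b42168429441390a5315862648059825216842d085a10a5104e4294c5618992016609485a10b4216842944139084216640b084210b3205840ec84210b320584210859902c10164210859902c210842cc816103b210842cc8161084216640b04059084216640b084210b3207640ec84210b320584210859902c10164210852903b2108429481d903b2108429481d9084214a40ec40590bf211042fc84410b42076429481490bf211042fc8440806216842d085a10b4216842d08549929209264a482490a9216842d085a10b4216842d085a083b215864b0c961891325864b0c96192c21924108414a184316844950c218442168400c85490a92080207c8421904427e644885f9926218040508060825205840b0816102c20524210842180c324a40208421029205840b0816102c102842108421925324a6494c92900b3008605085a10b921684298413908421086494c549925201660e485a10b4216842d041390a53158402cc1290b4216842d08528827214a62b08059825216842d085a10a5104e4294c5618ac2016609485a10b42168429441390a5315862308059825216842d085a10a5104e4294c56188c2016609485a10b42168429441390a5315862308059825216842d085a10a5104e4294c56188c2016609485a10b42168429441390a5315862308059825216842d085a10a5104e4294c56188c2016609485a10b421684294413801b217264e481a0814217264e481a0814217264e4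81a0814217264e481a0814217264e481a0814217264e481a081421726410c9c9034102840d085c90c3104640a481490292172430c85c9029205240a48148834205840b0816102c21724210c9290b9205840b0816102c205820d084910a32124428c81610292124428c84910a3101640a485f90a5205240ec81490bf203e40ec81d9029217e4294814903b205242fc85290292076202cc96192c212241144149084203e60b08120829215242a485490a9215240988131838327e423c81310a9215242a485490a9108040d0ca1988a21804094c5f90c0107240d08601034210820e486199392068205085c99392068205085c99392068205085c99392068205085c99392068205085c99392068205085c99392068205085c99392068205085c99392068205085c99392068205000d9034218640d084208392068430c81a1084107240d08619034210820e481a10c32068421041c9034218640d084208392068430c81a1084107240d08619034210820e481a10c32068421041c9034218640d041c9904217264108618834205240a48149029327e429886190c3205240a48149029205220d085f9084207642fc842103b207642fc842103b217e421081d880b212240b04149045209220a486490c9219243248549026210864fc82010a92152432486490c9219221148629014218a40984219034317e430c81a10c5107240d08619034218620e481a10c32068430c41c9034218640d084208392068430c81a1084107240d08619034210820e481a10c32068421041c9034218640d084208392068430c81a1084107240d08619034210820e481a10c32068421041c801b2068430c81a10c3107240d08619034218620e481a10c32068430c41c9034218640d086188392068430c81a10c3107240d08619034218620e481a10c3206843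0c41c90b9206842e481a08432068430c81a1084107240d085c9034108640a481490292172430c8619029205240a48148834304c42fc8531029304c42fc853103b2076609885f90a62052609885f90a62052202c8488829200840b84149026200864a4c549929211a610c82290432086410c40f90393286431442010c52072431481a08432068430c81a10c5107240d08619034218620e481a10c32068430c41c9034218640d086188392068430c81a10c3107240d08619034218620e481a10c32068430c41c9034218640d086188392068430c81a10c3107240d08619034218620e400d9034218640d08618839217240d085c9034108642e481a10b92068210c81a10c32068430c41c9034218640d08618839217240d085c9034108640d08619034218620e481a10c32068430c41c9034218640d08618839210840d085c9034108642e486190341024429485290bf216862fc85a18153052402c85f8820212220a48170829207e62a4846983f208a410c821903f103e40e4ca190c51080431481c90c52068210c8629039218a40d04219034218640d086288392068430c81a10c5107240d08619034218620e481a10c32068430c41c9034218640d086188392068430c81a10c3107240d08619034218620e481a10c32068430c41c9034218640d08618839003640d08619034218620e485c9034217240d04219034218640d086188392068430c81a10c3107240d08619034218620e481a10c32068430c41c90b9206842e481a0843217240d085c9034108642e481a10b92068210c8531034217240d042190b9218640d040910a5216842d0c5f90b4302a60a480590bf10404244414902e105240fcc54908d307e41148219043207e207c81c9943218a2100862903921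8a409842190c52072431481a0843218a40d085c9034108640d08619034218a20e481a10c32068431441c90b9206842e481a08432068430c81a10c3107240d08619034218620e481a10c32068430c41c9034218640d086188392068430c81a10c31072006c81a10c32068431441c9034218640d086288392068430c81a10c5107240d08619034218620e485c9034217240d04219034218640d08618839217240d085c9034108640d08619034218620e485c9034217240d042190a6206842e481a08432172430c81a0812214a42d085a18bf21686054c14900b217e20808488829205c20a481f98a931524234c1f90452086410c81f881f2072650c8628840218a40e486290261086431481c90c52068210c8629034217240d042190c5206842e481a08432068430c81a10c51072431481a10b92068210c81a10c32068431441c9034218640d086288392068430c81a10c5107240d08619034218a20e481a10c32068431441c801b2068430c81a10c5107240d08619034218a20e481a10c32068431441c9034218640d086288392068430c81a10c5107240d08619034218620e485c9034217240d042190b9206842e481a0843217240d085c90341086429881a10b92068210c85c90c32068204885f90b4216862fc85a18153052402c85f8820212220a48170829207e62a4c5c108d307e41148219043207e207c81c9943218a21008629039218a409842190c52072431481a0843218a40d085c9034108640d08619034218a20e481a10c32068431441c9034218640d086288392068430c81a10c51072431481a10b92068210c81a10c32068431441c9034218640d086288392068430c81a10c51072006c81a10c32068431441c9034218640d0862883920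68430c81a10c51072431481a10b92068210c8629034217240d042190b9206842e481a0843217240d085c9034108642e481a10b92068210c85c9034217240d042190a6206842e481a08432172430c81a0812217e42d085a18bf216860e0c14900b217e20808488829205c20a481f98a931704234c1f90452086410c81f881f2072650c8628840218a40e486290261086431481c90c52068210c8629034217240d042190c5206842e481a0843218a40d085c90341086431481a10b92068210c81a10c32068431441c9034218640d086288392068430c81a10c5107240d08619034218a20e481a10c32068431441c801b2068430c81a10c5107240d08619034218a20e481a10c32068431441c90c5206842e481a0843218a40d085c90341086431481a10b92068210c85c9034217240d04219034218640d08618839217240d085c90341086429881a10b92068210c85c90c32068204885f90b4216862fc85a18383052402c85f8820212220a48170829207e62a4c5c108d307e41148219043207e207c81c9943218a21008629039218a409842190c52072431481a0843218a40d085c90341086431481a10b92068210c8629034217240d04219034218640d08628839218a40d085c9034108640d08619034218a20e481a10c32068431441c90c5206842e481a0843218a40d085c90341086006c81a10c32068431441c9034218640d08628839218a40d085c90341086431481a10b92068210c8629034217240d042190c5206842e481a08432068430c81a10c3107240d08619034218620e485c9034217240d042190a6206842e481a08432172430c81a0812217e42d085a18bf216860e0c14900b217e20808488829205c20a481f98a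931704234c1f90452086410c81f881f2072650c8628840218a40e486290261086431481c90c52068210c8629034217240d042190c5206842e481a0843218a40d085c90341086431481a10b92068210c8629034217240d042190c5206842e481a08432068430c81a10c5107240d08619034218a20e481a10c32068431441c801b2068430c81a10c51072431481a10b92068210c8629034217240d042190c5206842e481a0843218a40d085c90341086431481a10b92068210c85c9034217240d042190b9206842e481a0843217240d085c90341086429881a10b92068210c85c90c32068204885f90b4216862fc85a18383052402c85f8820212220a48170829207e62a4c5c108d307e41148219043207e207c81c9943218a21008629039218a409842190c52072431481a0843218a40d085c90341086431481a10b92068210c8629034217240d042190c5206842e481a0843218a40d085c9034108640d08619034218a20e48629034217240d04219034218640d086288392068430c81a10c51072006c8629034217240d042190c5206842e481a08432068430c81a10c51072431481a10b92068210c8629034217240d042190c5206842e481a0843217240d085c9034108642e481a10b92068210c85c9034217240d042190a6206842e481a08432172430c81a0812217e42d085a18bf216860e0c14900b217e20808488829205c20a481f98a931704234c1f90452086410c81f881f2072650c8628840218a40e486290261086431481c90c52068210c8629034217240d042190c5206842e481a0843218a40d085c90341086431481a10b92068210c8629034217240d04219034218640d08628839218a40d085c90341086431481a10b92068210c81a1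0c32068431441c801b

theorem wordPairs_ne : ∀ w ∈ wordPairs, w.1 ++ w.2 ≠ w.2 ++ w.1 := by decide +kernel

set_option maxRecDepth 1000000 in
theorem forceFamilies_search_ne_zero :
    (forceFamilies pool fun P => forcePoints rootPoints fun R =>
      runAlive (fun _ => true) (search 15873147 P 16 []) R certificate) ≠ 0 := by
  decide +kernel

theorem runAlive_search_ne_zero :
    runAlive (fun _ => true) (search 15873147 pool 16 []) rootPoints certificate ≠ 0 := by
  have := forceFamilies_search_ne_zero
  rwa [forceFamilies_eq, forcePoints_eq] at this

/-! ### Symmetry under exchange of the coordinates -/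

theorem bakerInvFun_swap (p : ℝ × ℝ) : bakerInvFun p.swap = (bakerFun p).swap := by
  simp only [bakerInvFun, bakerFun, Prod.fst_swap, Prod.snd_swap]
  split_ifs <;> rfl

theorem swap_mem_halfOpenSquare {p : ℝ × ℝ} (hp : p ∈ halfOpenSquare) : p.swap ∈ halfOpenSquare :=
  ⟨hp.2, hp.1⟩

theorem bakerMap_zpow_swap (n : ℤ) (p : halfOpenSquare) :
    ((bakerMap ^ n) ⟨p.1.swap, swap_mem_halfOpenSquare p.2⟩ : ℝ × ℝ) =
      ((bakerMap ^ (-n)) p : ℝ × ℝ).swap := by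
  have hinv : ∀ q : halfOpenSquare, bakerMap⁻¹ ⟨q.1.swap, swap_mem_halfOpenSquare q.2⟩ =
      ⟨(bakerMap q : ℝ × ℝ).swap, swap_mem_halfOpenSquare (bakerMap q).2⟩ := fun q =>
    Subtype.ext (bakerInvFun_swap q.1)
  have key := perm_zpow_orbit bakerMap (fun n => ⟨((bakerMap ^ (-n)) p : ℝ × ℝ).swap,
    swap_mem_halfOpenSquare ((bakerMap ^ (-n)) p).2⟩) (by
      intro n
      have := hinv ((bakerMap ^ (-(n + 1))) p)
      rw [Equiv.Perm.inv_eq_iff_eq] at this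
      rw [this]
      congr 2
      rw [← Equiv.Perm.mul_apply, ← zpow_one_add, neg_add, add_comm (-n), add_neg_cancel_left])
  have := congrArg Subtype.val (key n)
  simpa using this

theorem survivorSet_preimage_swap (H : Set (ℝ × ℝ)) :
    survivorSet (Prod.swap ⁻¹' H) ⊆ Prod.swap ⁻¹' survivorSet H := by
  rintro p ⟨hp, h⟩
  refine ⟨swap_mem_halfOpenSquare hp, fun n => ?_⟩
  have := h (-n)
  rw [Set.mem_preimage, ← bakerMap_zpow_swap n ⟨p, hp⟩] at this
  exact this

theorem dimH_survivorSet_preimage_swap {H : Set (ℝ × ℝ)} (h : dimH (survivorSet H) = 0) :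
    dimH (survivorSet (Prod.swap ⁻¹' H)) = 0 := by
  have hiso : Isometry (Prod.swap : ℝ × ℝ → ℝ × ℝ) := fun p q => max_comm _ _
  have h1 := (hiso.dimH_image (survivorSet (Prod.swap ⁻¹' H))).ge
  have h2 := h1.trans (dimH_mono ((Set.image_mono (survivorSet_preimage_swap H)).trans
    (Set.image_preimage_subset _ _)))
  rw [h] at h2
  exact le_antisymm h2 bot_le

/-- The single letter 1 is on one side of the origin at most, so one coordinate vanishes. -/
theorem eq_zero_or_mem_rootPoints {p : Pt} (hp : p ∈ windows [false] [true]) :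
    p.y = 0 ∨ ⟨p.y, p.x⟩ ∈ rootPoints := by
  have h : (windows [false] [true]).all (fun p => Nat.beq p.y 0 ||
      rootPoints.any fun r => Nat.beq r.x p.y && Nat.beq r.y p.x) = true := by decide +kernel
  rw [List.all_eq_true] at h
  have := h p hp
  rw [Bool.or_eq_true, Nat.beq_eq, List.any_eq_true] at this
  refine this.imp_right ?_
  rintro ⟨⟨x, y⟩, hr, h⟩
  rw [Bool.and_eq_true, Nat.beq_eq, Nat.beq_eq] at h
  rwa [← h.1, ← h.2]

/-! ### The area bound -/

/-- The area of a convex hole with a zero-dimensional survivor set is bounded below. -/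
theorem le_volume_of_mem_rootPoints {H : Set (ℝ × ℝ)} (hconv : Convex ℝ H) (hsub : H ⊆ unitSquare)
    (hdim : dimH (survivorSet H) = 0) {p : Pt} (hp : p ∈ rootPoints) {q : ℝ × ℝ} (hq : q ∈ H)
    (hpq : q.1 - 1 / 8192 ≤ p.toPlane.1 ∧ p.toPlane.1 ≤ q.1 ∧
      q.2 - 1 / 8192 ≤ p.toPlane.2 ∧ p.toPlane.2 ≤ q.2) :
    ENNReal.ofReal 0.11802 ≤ MeasureTheory.volume H := by
  obtain ⟨K, hK, hKmem, hKvol⟩ := exists_convex_thickening hconv hsub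
    (show (0 : ℝ) ≤ 1 / 8192 by norm_num)
  have hmem : ∀ {q : ℝ × ℝ} {p : Pt}, q ∈ H → (q.1 - 1 / 8192 ≤ p.toPlane.1 ∧ p.toPlane.1 ≤ q.1 ∧
      q.2 - 1 / 8192 ≤ p.toPlane.2 ∧ p.toPlane.2 ≤ q.2) → p.toPlane ∈ K :=
    fun hq h => hKmem _ hq _ h.1 h.2.1 h.2.2.1 h.2.2.2
  obtain ⟨c, hc⟩ := exists_of_runAlive runAlive_search_ne_zero hp rfl
  have hvol := volume_ge_of_search (B := 15873147) (by norm_num) (pool := pool) (by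
      simp [pool, wordPairs, wordCodes]) ?_ hK ?_ 16 [] p c hc trivial ?_
  · have h1 := hvol.trans hKvol
    by_contra hlt
    rw [not_le] at hlt
    -- 15873147 is the least integer not below `2²⁷ (0.11802 + 2ε + ε²)` for `ε = 1/8192`. The
    -- factor `2²⁷` is `2²⁶` for the grid times 2 for doubled areas.
    have h2 : ENNReal.ofReal ((15873147 : ℕ) / 2 ^ 27) <
        ENNReal.ofReal (0.11802 + (2 * (1 / 8192) + (1 / 8192) ^ 2)) := by
      rw [ENNReal.ofReal_add (by norm_num) (by norm_num)]
      exact h1.trans_lt (ENNReal.add_lt_add_right ENNReal.ofReal_ne_top hlt)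
    rw [ENNReal.ofReal_lt_ofReal_iff (by norm_num)] at h2
    norm_num at h2
  · intro fam hfam a ha
    obtain ⟨w, -, rfl⟩ := List.mem_map.1 hfam
    exact inGrid_of_mem_scan ha
  · intro fam hfam
    obtain ⟨w, hw, rfl⟩ := List.mem_map.1 hfam
    obtain ⟨q, hq, a, ha, h⟩ := exists_mem_windows_of_dimH_eq_zero hdim (wordPairs_ne w hw)
    exact ⟨a, ha, hmem hq h⟩
  · intro a ha
    rw [List.mem_singleton] at ha
    subst ha
    exact ⟨inGrid_of_mem_scan (List.mem_filter.1 hp).1, hmem hq hpq⟩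

theorem le_volume_of_dimH_eq_zero {H : Set (ℝ × ℝ)} (hconv : Convex ℝ H) (hsub : H ⊆ unitSquare)
    (hdim : dimH (survivorSet H) = 0) : ENNReal.ofReal 0.11802 ≤ MeasureTheory.volume H := by
  obtain ⟨q, hq, p, hp, hpq⟩ := exists_mem_windows_of_dimH_eq_zero hdim
    (u := [false]) (v := [true]) (by decide)
  rcases eq_zero_or_mem_rootPoints hp with h | h
  · exact le_volume_of_mem_rootPoints hconv hsub hdim
      (List.mem_filter.2 ⟨hp, by simpa using h⟩) hq hpq
  · have := le_volume_of_mem_rootPoints (convex_preimage_swap hconv)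
      (H := Prod.swap ⁻¹' H) (fun a ha => ⟨(hsub ha).2, (hsub ha).1⟩)
      (dimH_survivorSet_preimage_swap hdim) h (q := q.swap) (by simpa using hq)
      ⟨hpq.2.2.1, hpq.2.2.2, hpq.1, hpq.2.1⟩
    rwa [volume_preimage_swap (hconv.nullMeasurableSet _)] at this

theorem mainTheorem2 (H : Set (ℝ × ℝ)) (hH : IsHole H) (hconv : Convex ℝ H)
    (harea : MeasureTheory.volume H < ENNReal.ofReal 0.11802) :
    0 < dimH (survivorSet H) ∧ ¬ IsDimensionTrap H := by
  have hsub : H ⊆ unitSquare := by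
    obtain ⟨U, -, rfl⟩ := hH
    exact Set.inter_subset_right
  have hne : dimH (survivorSet H) ≠ 0 := fun h =>
    harea.not_ge (le_volume_of_dimH_eq_zero hconv hsub h)
  exact ⟨pos_iff_ne_zero.2 hne, fun h => hne h.2⟩
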